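/- Let $0<s<1$, let $N\ge 1$ be an integer with $N>2s$, and let $\Omega\subset\mathbb{R}^N$ be a bounded domain with smooth boundary. Put $$X_0^s(\Omega)=\{u\in H^s(\mathbb{R}^N):\ u=0\ \text{a.e. in}\ \mathbb{R}^N\setminus\Omega\},\qquad \|u\|_{X_0^s(\Omega)}=\Big(\int_{\mathbb{R}^N\times\mathbb{R}^N}\frac{|u(x)-u(y)|^2}{|x-y|^{N+2s}}\,dx\,dy\Big)^{1/2}.$$ Let $0<p<1$, and let $f:[0,\infty)\to\mathbb{R}$ be continuous with $f(0)=0$. Write $F(t)=\int_0^t f(\tau)\,d\tau$ and assume $$(f_0)\qquad -\infty<\liminf_{t\to0^+}\frac{F(t)}{t^2}\le\limsup_{t\to0^+}\frac{F(t)}{t^2}=+\infty\quad\text{and}\quad \liminf_{t\to0^+}\frac{f(t)}{t}<0 .$$ For $\lambda\in\mathbb{R}$ consider the problem $$(P_\lambda)\qquad (-\Delta)^s u=\lambda u^p+f(u)\ \text{ in }\Omega,\qquad u>0\ \text{ in }\Omega,\qquad u=0\ \text{ in }\mathbb{R}^N\setminus\Omega .$$ A weak solution of $(P_\lambda)$ is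 a function $u\in X_0^s(\Omega)$ with $u>0$ a.e. in $\Omega$ such that, for every $\varphi\in X_0^s(\Omega)$, the functions $u^p\varphi$ and $f(u)\varphi$ are integrable on $\Omega$ and $$\int_{\mathbb{R}^N\times\mathbb{R}^N}\frac{(u(x)-u(y))(\varphi(x)-\varphi(y))}{|x-y|^{N+2s}}\,dx\,dy=\lambda\int_\Omega u^p\varphi\,dx+\int_\Omega f(u)\varphi\,dx .$$ **Theorem 1.2.** For every $k\in\mathbb{N}$ there is $\lambda_k>0$ such that, for every $\lambda\in[-\lambda_k,\lambda_k]$, problem $(P_\lambda)$ has at least $k$ distinct weak solutions $u_{1,\lambda},\dots,u_{k,\lambda}$ (distinct as elements of $X_0^s(\Omega)$), and these satisfy $$\|u_{i,\lambda}\|_{X_0^s(\Omega)}<\frac1i\quad\text{and}\quad\|u_{i,\lambda}\|_{L^\infty(\Omega)}<\frac1i\qquad\text{for all } i\in\{1,\dots,k\}.$$ -/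

import Mathlib

open MeasureTheory Filter Topology
open scoped ENNReal ContDiff

namespace FracLap

/-- A bounded domain (nonempty connected open set) of `ℝ^N` with smooth boundary: near each boundary
point the set is the sublevel set `{ρ < 0}` of a smooth function `ρ` whose differential does not
vanish at that point. -/
structure IsBoundedSmoothDomain {N : ℕ} (Ω : Set (EuclideanSpace ℝ (Fin N))) : Prop where
  isOpen : IsOpen Ω
  isConnected : IsConnected Ω
  isBounded : Bornology.IsBounded Ω
  smooth_boundary : ∀ x ∈ frontier Ω, ∃ (U : Set (EuclideanSpace ℝ (Fin N)))
    (ρ : EuclideanSpace ℝ (Fin N) → ℝ), IsOpen U ∧ x ∈ U ∧ ContDiffOn ℝ ∞ ρ U ∧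
      fderiv ℝ ρ x ≠ 0 ∧ Ω ∩ U = {y ∈ U | ρ y < 0}

/-- The norm of `X_0^s`, with values in `[0, ∞]`:
`(∫∫ |u(x) - u(y)|² / |x - y|^(N + 2s) dx dy)^(1/2)`. -/
noncomputable def gagliardoNorm {N : ℕ} (s : ℝ) (u : EuclideanSpace ℝ (Fin N) → ℝ) : ℝ≥0∞ :=
  (∫⁻ z : EuclideanSpace ℝ (Fin N) × EuclideanSpace ℝ (Fin N),
    ENNReal.ofReal (|u z.1 - u z.2| ^ 2 / ‖z.1 - z.2‖ ^ ((N : ℝ) + 2 * s))) ^ (1 / 2 : ℝ)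

/-- The scalar product of `X_0^s`:
`∫∫ (u(x) - u(y)) (φ(x) - φ(y)) / |x - y|^(N + 2s) dx dy`. -/
noncomputable def gagliardoForm {N : ℕ} (s : ℝ) (u φ : EuclideanSpace ℝ (Fin N) → ℝ) : ℝ :=
  ∫ z : EuclideanSpace ℝ (Fin N) × EuclideanSpace ℝ (Fin N),
    (u z.1 - u z.2) * (φ z.1 - φ z.2) / ‖z.1 - z.2‖ ^ ((N : ℝ) + 2 * s)

/-- `u` (a representative) belongs to `X_0^s(Ω)`: it lies in `H^s(ℝ^N)`, that is, `u ∈ L²(ℝ^N)` with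
finite Gagliardo seminorm, and `u = 0` a.e. in `ℝ^N \ Ω`. -/
structure MemX0 {N : ℕ} (s : ℝ) (Ω : Set (EuclideanSpace ℝ (Fin N)))
    (u : EuclideanSpace ℝ (Fin N) → ℝ) : Prop where
  memLp : MemLp u 2 volume
  gagliardoNorm_lt_top : gagliardoNorm s u < ⊤
  eq_zero : ∀ᵐ x, x ∉ Ω → u x = 0

/-- `u` is a weak solution of `(-Δ)^s u = lam * u^p + f(u)`, `u > 0` in `Ω`, `u = 0` in `ℝ^N \ Ω`.
The integrals on the right-hand side are required to exist. -/
structure IsWeakSolution {N : ℕ} (s : ℝ) (Ω : Set (EuclideanSpace ℝ (Fin N))) (p lam : ℝ)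
    (f : ℝ → ℝ) (u : EuclideanSpace ℝ (Fin N) → ℝ) : Prop where
  memX0 : MemX0 s Ω u
  pos : ∀ᵐ x, x ∈ Ω → 0 < u x
  integrable_pow : ∀ φ, MemX0 s Ω φ → IntegrableOn (fun x => u x ^ p * φ x) Ω
  integrable_f : ∀ φ, MemX0 s Ω φ → IntegrableOn (fun x => f (u x) * φ x) Ω
  weak_eq : ∀ φ, MemX0 s Ω φ →
    gagliardoForm s u φ = lam * (∫ x in Ω, u x ^ p * φ x) + ∫ x in Ω, f (u x) * φ x

/-- The oscillation condition at the origin, for `F(t) = ∫_0^t f`, with limits inferior and superior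
in `[-∞, ∞]`: `-∞ < liminf F(t)/t² ≤ limsup F(t)/t² = +∞` and `liminf f(t)/t < 0` as `t → 0+`. -/
structure OscillatesAtZero (f : ℝ → ℝ) : Prop where
  liminf_primitive : (⊥ : EReal) <
    liminf (fun t : ℝ => (((∫ τ in (0 : ℝ)..t, f τ) / t ^ 2 : ℝ) : EReal)) (𝓝[>] 0)
  limsup_primitive :
    limsup (fun t : ℝ => (((∫ τ in (0 : ℝ)..t, f τ) / t ^ 2 : ℝ) : EReal)) (𝓝[>] 0) = ⊤
  liminf_neg : liminf (fun t : ℝ => ((f t / t : ℝ) : EReal)) (𝓝[>] 0) < 0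

end FracLap

/-! Solutions are global minimizers of truncated energies. Since `f` is negative at points
arbitrarily close to 0, pick a small `d` with `f d < 0` and freeze the reaction `lam * t ^ p + f t`
outside `[0, d]`. If `|lam| ≤ -f d`, the truncated reaction is bounded, vanishes for `t ≤ 0` and is
nonpositive for `t ≥ d`. Projecting a function onto `[0, d]` then does not raise the energy, so the
direct method gives a minimizer over the whole space with values in `[0, d]` (`exists_minimizer`).
Its Euler–Lagrange equation is the original one, because the truncation is inactive on its range.

The minimum is negative. At a height `t < d` with `F(t) / t ^ 2` large, `t` times a cutoff gains
more on its plateau than it pays in seminorm and in the transition region, where `F ≥ -C t²`. For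
`|lam|` small against `t ^ 2` the minimum stays below `-t ^ 2 / 2`. This forces a lower bound on the
supremum of the minimizer that does not depend on `lam`, while a small `d` makes both the supremum
and the seminorm small (`exists_small_weakSolution`). Choosing each new solution below the lower
bound for the earlier ones makes them distinct.

Positivity is where nonlocality enters: for `lam < 0` the reaction has no linear lower bound coming
from `lam * t ^ p`. But the nonlocal form couples the zero set of `u` to its positivity set with a
strict sign, while the reaction vanishes on the zero set (`zeroSet_null_or_ae_eq_zero`). -/

namespace FracLap

/-- Euclidean space of dimension `N`. -/
abbrev Euc (N : ℕ) := EuclideanSpace ℝ (Fin N)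

/-- The difference quotient `(u(x) - u(y)) / |x - y|^((N + 2s)/2)`, whose `L²` norm is the
Gagliardo seminorm. -/
noncomputable def diffQuot {N : ℕ} (s : ℝ) (u : Euc N → ℝ) (z : Euc N × Euc N) : ℝ :=
  (u z.1 - u z.2) / ‖z.1 - z.2‖ ^ (((N : ℝ) + 2 * s) / 2)

/-! ### The Gagliardo form as an `L²` pairing of difference quotients. -/

section Basic

variable {N : ℕ} {s : ℝ} {Ω : Set (Euc N)} {u v φ : Euc N → ℝ}

theorem rpow_half_mul_self (N : ℕ) (s : ℝ) (x : Euc N) :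
    ‖x‖ ^ (((N : ℝ) + 2 * s) / 2) * ‖x‖ ^ (((N : ℝ) + 2 * s) / 2) = ‖x‖ ^ ((N : ℝ) + 2 * s) := by
  rw [← sq, ← Real.rpow_natCast, ← Real.rpow_mul (norm_nonneg _)]
  congr 1
  push_cast
  ring

theorem diffQuot_mul_diffQuot (s : ℝ) (u v : Euc N → ℝ) (z : Euc N × Euc N) :
    diffQuot s u z * diffQuot s v z =
      (u z.1 - u z.2) * (v z.1 - v z.2) / ‖z.1 - z.2‖ ^ ((N : ℝ) + 2 * s) := by
  rw [diffQuot, diffQuot, div_mul_div_comm, rpow_half_mul_self]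

/-- Splitting the kernel evenly between the two factors lets `L²` theory supply integrability,
bilinearity and semicontinuity. -/
theorem gagliardoForm_eq (s : ℝ) (u v : Euc N → ℝ) :
    gagliardoForm s u v = ∫ z, diffQuot s u z * diffQuot s v z := by
  simp only [gagliardoForm, diffQuot_mul_diffQuot]

theorem gagliardoNorm_eq (s : ℝ) (u : Euc N → ℝ) :
    gagliardoNorm s u = eLpNorm (diffQuot s u) 2 volume := by
  rw [eLpNorm_eq_lintegral_rpow_enorm_toReal (by simp) (by simp), gagliardoNorm]
  simp only [ENNReal.toReal_ofNat, ENNReal.rpow_ofNat]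
  congr 1
  refine lintegral_congr fun z => ?_
  rw [← enorm_pow, Real.enorm_eq_ofReal (by positivity), sq_abs, sq, sq, diffQuot_mul_diffQuot]

theorem aestronglyMeasurable_diffQuot (hu : AEStronglyMeasurable u volume) :
    AEStronglyMeasurable (diffQuot s u) volume := by
  have h1 : AEStronglyMeasurable (fun z : Euc N × Euc N => u z.1) volume :=
    hu.comp_quasiMeasurePreserving Measure.quasiMeasurePreserving_fst
  have h2 : AEStronglyMeasurable (fun z : Euc N × Euc N => u z.2) volume :=
    hu.comp_quasiMeasurePreserving Measure.quasiMeasurePreserving_snd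
  have h3 : Measurable (fun z : Euc N × Euc N => ‖z.1 - z.2‖ ^ (((N : ℝ) + 2 * s) / 2)) := by
    fun_prop
  exact ((h1.sub h2).aemeasurable.div h3.aemeasurable).aestronglyMeasurable

theorem diffQuot_add (s : ℝ) (u v : Euc N → ℝ) :
    diffQuot s (fun x => u x + v x) = fun z => diffQuot s u z + diffQuot s v z := by
  ext z
  simp only [diffQuot]
  ring

theorem diffQuot_const_mul (s c : ℝ) (u : Euc N → ℝ) :
    diffQuot s (fun x => c * u x) = fun z => c * diffQuot s u z := by
  ext z
  simp only [diffQuot]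
  ring

theorem MemX0.diffQuot_memLp (h : MemX0 s Ω u) : MemLp (diffQuot s u) 2 volume :=
  ⟨aestronglyMeasurable_diffQuot h.memLp.1, by
    rw [← gagliardoNorm_eq]; exact h.gagliardoNorm_lt_top⟩

theorem MemX0.of_memLp (h : MemLp u 2 volume) (hD : MemLp (diffQuot s u) 2 volume)
    (h0 : ∀ᵐ x, x ∉ Ω → u x = 0) : MemX0 s Ω u :=
  ⟨h, by rw [gagliardoNorm_eq]; exact hD.2, h0⟩

theorem MemX0.add (hu : MemX0 s Ω u) (hv : MemX0 s Ω v) : MemX0 s Ω (fun x => u x + v x) := by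
  refine .of_memLp (hu.memLp.add hv.memLp) ?_ ?_
  · rw [diffQuot_add]
    exact hu.diffQuot_memLp.add hv.diffQuot_memLp
  · filter_upwards [hu.eq_zero, hv.eq_zero] with x h1 h2 hx
    rw [h1 hx, h2 hx, add_zero]

theorem MemX0.const_mul (hu : MemX0 s Ω u) (c : ℝ) : MemX0 s Ω (fun x => c * u x) := by
  refine .of_memLp (hu.memLp.const_mul c) ?_ ?_
  · rw [diffQuot_const_mul]
    exact hu.diffQuot_memLp.const_mul c
  · filter_upwards [hu.eq_zero] with x h1 hx
    rw [h1 hx, mul_zero]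

theorem memX0_zero : MemX0 s Ω (fun _ => 0) := by
  refine .of_memLp MemLp.zero ?_ (ae_of_all _ fun _ _ => rfl)
  have : diffQuot s (fun _ : Euc N => (0 : ℝ)) = fun _ => 0 := by
    ext z
    simp [diffQuot]
  rw [this]
  exact MemLp.zero

theorem abs_diffQuot_comp_le {ψ : ℝ → ℝ} {C : ℝ} (hψ : ∀ a b, |ψ a - ψ b| ≤ C * |a - b|)
    (u : Euc N → ℝ) (z : Euc N × Euc N) :
    |diffQuot s (fun x => ψ (u x)) z| ≤ C * |diffQuot s u z| := by
  simp only [diffQuot, abs_div]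
  rw [← mul_div_assoc]
  exact div_le_div_of_nonneg_right (hψ _ _) (abs_nonneg _)

theorem memLp_diffQuot_comp {ψ : ℝ → ℝ} {C : ℝ} (hψc : Continuous ψ)
    (hψ : ∀ a b, |ψ a - ψ b| ≤ C * |a - b|) (hu : AEStronglyMeasurable u volume)
    (hD : MemLp (diffQuot s u) 2 volume) : MemLp (diffQuot s (fun x => ψ (u x))) 2 volume := by
  refine (hD.const_mul C).mono
    (aestronglyMeasurable_diffQuot (hψc.comp_aestronglyMeasurable hu)) (ae_of_all _ fun z => ?_)
  refine (abs_diffQuot_comp_le hψ u z).trans ?_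
  rw [Real.norm_eq_abs, abs_mul]
  exact mul_le_mul_of_nonneg_right (le_abs_self C) (abs_nonneg _)

theorem MemX0.comp {ψ : ℝ → ℝ} {C : ℝ} (hψc : Continuous ψ)
    (hψ : ∀ a b, |ψ a - ψ b| ≤ C * |a - b|) (hψ0 : ψ 0 = 0) (hu : MemX0 s Ω u) :
    MemX0 s Ω (fun x => ψ (u x)) := by
  refine .of_memLp ?_ (memLp_diffQuot_comp hψc hψ hu.memLp.1 hu.diffQuot_memLp) ?_
  · refine (hu.memLp.const_mul C).mono (hψc.comp_aestronglyMeasurable hu.memLp.1)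
      (ae_of_all _ fun x => ?_)
    have := hψ (u x) 0
    rw [hψ0, sub_zero, sub_zero] at this
    rw [Real.norm_eq_abs, Real.norm_eq_abs, abs_mul]
    exact this.trans (mul_le_mul_of_nonneg_right (le_abs_self C) (abs_nonneg _))
  · filter_upwards [hu.eq_zero] with x h1 hx
    rw [h1 hx, hψ0]

/-- A bounded function with finite seminorm is a multiplier on the bounded functions of `X_0^s`. -/
theorem MemX0.mul_bounded (hφ : MemX0 s Ω φ) (hu : AEStronglyMeasurable u volume)
    (hD : MemLp (diffQuot s u) 2 volume) (hφb : ∀ x, |φ x| ≤ 1) (hub : ∀ x, |u x| ≤ 1) :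
    MemX0 s Ω (fun x => u x * φ x) := by
  have hm : AEStronglyMeasurable (fun x => u x * φ x) volume := hu.mul hφ.memLp.1
  refine .of_memLp ?_ ?_ ?_
  · refine hφ.memLp.mono hm (ae_of_all _ fun x => ?_)
    rw [norm_mul, Real.norm_eq_abs, Real.norm_eq_abs]
    exact mul_le_of_le_one_left (abs_nonneg _) (hub x)
  · refine (hD.norm.add hφ.diffQuot_memLp.norm).mono (aestronglyMeasurable_diffQuot hm)
      (ae_of_all _ fun z => ?_)
    have key : diffQuot s (fun x => u x * φ x) z =
        φ z.1 * diffQuot s u z + u z.2 * diffQuot s φ z := by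
      simp only [diffQuot]
      ring
    rw [key]
    refine (norm_add_le _ _).trans (le_trans ?_ (le_abs_self _))
    simp only [Pi.add_apply, norm_mul, Real.norm_eq_abs]
    exact add_le_add (mul_le_of_le_one_left (abs_nonneg _) (hφb _))
      (mul_le_of_le_one_left (abs_nonneg _) (hub _))
  · filter_upwards [hφ.eq_zero] with x h1 hx
    rw [h1 hx, mul_zero]

theorem gagliardoForm_add_mul (hu : MemX0 s Ω u) (hφ : MemX0 s Ω φ) (t : ℝ) :
    gagliardoForm s (fun x => u x + t * φ x) (fun x => u x + t * φ x) =
      gagliardoForm s u u + t * (2 * gagliardoForm s u φ) + t ^ 2 * gagliardoForm s φ φ := by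
  simp only [gagliardoForm_eq, diffQuot_add, diffQuot_const_mul]
  have h1 := hu.diffQuot_memLp.integrable_mul hu.diffQuot_memLp
  have h2 := hu.diffQuot_memLp.integrable_mul hφ.diffQuot_memLp
  have h3 := hφ.diffQuot_memLp.integrable_mul hφ.diffQuot_memLp
  simp only [Pi.mul_def] at h1 h2 h3
  have h4 := (h2.const_mul 2).const_mul t
  rw [← integral_const_mul, ← integral_const_mul, ← integral_const_mul, ← integral_add h1 h4,
    ← integral_add (by exact h1.add h4) (h3.const_mul _)]
  refine integral_congr_ae (ae_of_all _ fun z => ?_)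
  ring

theorem gagliardoForm_const_mul_self (c : ℝ) (u : Euc N → ℝ) :
    gagliardoForm s (fun x => c * u x) (fun x => c * u x) = c ^ 2 * gagliardoForm s u u := by
  simp only [gagliardoForm_eq, diffQuot_const_mul]
  rw [← integral_const_mul]
  refine integral_congr_ae (ae_of_all _ fun z => ?_)
  ring

theorem gagliardoForm_self_nonneg (u : Euc N → ℝ) : 0 ≤ gagliardoForm s u u := by
  rw [gagliardoForm_eq]
  exact integral_nonneg fun z => mul_self_nonneg _

theorem gagliardoNorm_eq_ofReal_sqrt (hu : MemX0 s Ω u) :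
    gagliardoNorm s u = ENNReal.ofReal (√(gagliardoForm s u u)) := by
  rw [gagliardoNorm_eq, hu.diffQuot_memLp.eLpNorm_eq_integral_rpow_norm (by simp) (by simp),
    gagliardoForm_eq, Real.sqrt_eq_rpow]
  simp [sq]

/-- Normal contractions shrink every difference quotient; this is applied to the projection onto
`[0, d]`. -/
theorem gagliardoForm_comp_le {ψ : ℝ → ℝ} (hψc : Continuous ψ)
    (hψ : ∀ a b, |ψ a - ψ b| ≤ |a - b|) (hψ0 : ψ 0 = 0) (hu : MemX0 s Ω u) :
    gagliardoForm s (fun x => ψ (u x)) (fun x => ψ (u x)) ≤ gagliardoForm s u u := by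
  have hψ' : ∀ a b, |ψ a - ψ b| ≤ 1 * |a - b| := by simpa using hψ
  have hv := hu.comp hψc hψ' hψ0
  rw [gagliardoForm_eq, gagliardoForm_eq]
  refine integral_mono (hv.diffQuot_memLp.integrable_mul hv.diffQuot_memLp)
    (hu.diffQuot_memLp.integrable_mul hu.diffQuot_memLp) fun z => ?_
  simp only [← sq]
  have := abs_diffQuot_comp_le (s := s) hψ' u z
  rw [one_mul] at this
  exact sq_le_sq.mpr this

end Basic

/-! ### Cutoff functions have finite seminorm. -/

section Bump

variable {N : ℕ} {s : ℝ} {Ω : Set (Euc N)}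

/-- In polar coordinates the radial integrand is `t ^ (1 - 2s)` near 0, integrable as `s < 1`, and
`t ^ (-1 - 2s)` at infinity, integrable as `s > 0`. -/
theorem integrable_min_one_sq_div (hN : N ≠ 0) (hs0 : 0 < s) (hs1 : s < 1) :
    Integrable (fun x : Euc N => min 1 (‖x‖ ^ 2) / ‖x‖ ^ ((N : ℝ) + 2 * s)) := by
  have : Nonempty (Fin N) := ⟨⟨0, Nat.pos_of_ne_zero hN⟩⟩
  rw [integrable_fun_norm_addHaar volume (f := fun t : ℝ => min 1 (t ^ 2) / t ^ ((N : ℝ) + 2 * s)),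
    finrank_euclideanSpace_fin, ← Set.Ioc_union_Ioi_eq_Ioi zero_le_one, integrableOn_union]
  have key : ∀ t : ℝ, 0 < t → ∀ a : ℝ, t ^ (N - 1) • (t ^ a / t ^ ((N : ℝ) + 2 * s)) =
      t ^ (a - 1 - 2 * s) := by
    intro t ht a
    rw [← Real.rpow_natCast, ← Real.rpow_sub ht, smul_eq_mul, ← Real.rpow_add ht,
      Nat.cast_sub (Nat.one_le_iff_ne_zero.mpr hN)]
    congr 1
    push_cast
    ring
  constructor
  · have h : IntegrableOn (fun t : ℝ => t ^ ((2 : ℝ) - 1 - 2 * s)) (Set.Ioc 0 1) := by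
      rw [← intervalIntegrable_iff_integrableOn_Ioc_of_le zero_le_one]
      exact intervalIntegral.intervalIntegrable_rpow' (by linarith)
    refine h.congr_fun (fun t ht => ?_) measurableSet_Ioc
    simp only
    rw [min_eq_right (pow_le_one₀ ht.1.le ht.2), ← key t ht.1 2, Real.rpow_two]
  · have h : IntegrableOn (fun t : ℝ => t ^ ((0 : ℝ) - 1 - 2 * s)) (Set.Ioi 1) :=
      integrableOn_Ioi_rpow_of_lt (by linarith) zero_lt_one
    refine h.congr_fun (fun t ht => ?_) measurableSet_Ioi
    have ht' : (1 : ℝ) < t := ht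
    simp only
    rw [min_eq_left (one_le_pow₀ ht'.le), ← key t (by linarith) 0, Real.rpow_zero]

/-- The shear `(x, y) ↦ (x - y, y)` preserves measure and turns the integrand into a product of
functions of separate variables. -/
theorem integrable_kernel_mul_indicator (hN : N ≠ 0) (hs0 : 0 < s) (hs1 : s < 1)
    {B : Set (Euc N)} (hB : MeasurableSet B) (hBf : volume B ≠ ⊤) :
    Integrable (fun z : Euc N × Euc N =>
      min 1 (‖z.1 - z.2‖ ^ 2) / ‖z.1 - z.2‖ ^ ((N : ℝ) + 2 * s) * B.indicator 1 z.2) := by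
  have h1 := (integrable_min_one_sq_div hN hs0 hs1).mul_prod
    ((integrable_indicator_iff hB).mpr (integrableOn_const (C := (1 : ℝ)) hBf))
  exact (measurePreserving_sub_prod volume volume).integrable_comp_of_integrable h1

theorem memLp_diffQuot_of_lipschitz (hN : N ≠ 0) (hs0 : 0 < s) (hs1 : s < 1)
    {w : Euc N → ℝ} {L M : ℝ} (hw : Continuous w) (hL : ∀ x y, |w x - w y| ≤ L * ‖x - y‖)
    (hM : ∀ x, |w x| ≤ M) {B : Set (Euc N)} (hB : MeasurableSet B) (hBf : volume B ≠ ⊤)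
    (hwB : ∀ x ∉ B, w x = 0) : MemLp (diffQuot s w) 2 volume := by
  have hm := aestronglyMeasurable_diffQuot (s := s) hw.aestronglyMeasurable
  rw [memLp_two_iff_integrable_sq hm]
  have h1 := integrable_kernel_mul_indicator hN hs0 hs1 hB hBf
  have h2 := h1.swap
  refine ((h1.add h2).const_mul (L ^ 2 + (2 * M) ^ 2)).mono' (hm.pow 2) (ae_of_all _ fun z => ?_)
  rw [Real.norm_eq_abs, abs_of_nonneg (sq_nonneg _), sq, diffQuot_mul_diffQuot, ← sq]
  simp only [Pi.add_apply, Function.comp, Prod.fst_swap, Prod.snd_swap]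
  rw [norm_sub_rev z.2 z.1, ← mul_add, div_mul_eq_mul_div, ← mul_div_assoc]
  refine div_le_div_of_nonneg_right ?_ (by positivity)
  -- Pairs with both points outside `B` contribute nothing; for all others the two indicators add up
  -- to at least 1.
  by_cases hz : z.1 ∉ B ∧ z.2 ∉ B
  · rw [hwB _ hz.1, hwB _ hz.2, Set.indicator_of_notMem hz.1, Set.indicator_of_notMem hz.2]
    simp
  · have hi : (1 : ℝ) ≤ B.indicator 1 z.2 + B.indicator 1 z.1 := by
      by_cases h1 : z.1 ∈ B
      · have : (0 : ℝ) ≤ B.indicator 1 z.2 := Set.indicator_nonneg (fun _ _ => zero_le_one) _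
        rw [Set.indicator_of_mem h1]
        simpa using this
      · have h2 : z.2 ∈ B := by
          by_contra h2
          exact hz ⟨h1, h2⟩
        rw [Set.indicator_of_mem h2, Set.indicator_of_notMem h1]
        simp
    have hsq : (w z.1 - w z.2) ^ 2 ≤ (L ^ 2 + (2 * M) ^ 2) * min 1 (‖z.1 - z.2‖ ^ 2) := by
      have e1 : (w z.1 - w z.2) ^ 2 ≤ L ^ 2 * ‖z.1 - z.2‖ ^ 2 := by
        rw [← mul_pow, ← sq_abs]
        exact pow_le_pow_left₀ (abs_nonneg _) (hL _ _) 2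
      have e2 : (w z.1 - w z.2) ^ 2 ≤ (2 * M) ^ 2 := by
        rw [← sq_abs]
        refine pow_le_pow_left₀ (abs_nonneg _) ?_ 2
        linarith [abs_sub (w z.1) (w z.2), hM z.1, hM z.2]
      rcases min_cases 1 (‖z.1 - z.2‖ ^ 2) with ⟨h, -⟩ | ⟨h, -⟩ <;> rw [h] <;>
        nlinarith [sq_nonneg L, mul_nonneg (sq_nonneg (2 * M)) (sq_nonneg ‖z.1 - z.2‖)]
    have hp : 0 ≤ (L ^ 2 + (2 * M) ^ 2) * min 1 (‖z.1 - z.2‖ ^ 2) := by positivity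
    rw [← mul_assoc]
    nlinarith

/-- The cutoff function equal to `1` on the ball of radius `r` around `a`, to `0` outside the ball
of radius `2r`, and interpolating linearly in between. -/
noncomputable def cutoff {N : ℕ} (a : Euc N) (r : ℝ) (x : Euc N) : ℝ :=
  max 0 (min 1 (2 - ‖x - a‖ / r))

theorem cutoff_nonneg (a : Euc N) (r : ℝ) (x : Euc N) : 0 ≤ cutoff a r x := le_max_left _ _

theorem cutoff_le_one (a : Euc N) (r : ℝ) (x : Euc N) : cutoff a r x ≤ 1 :=
  max_le zero_le_one (min_le_left _ _)

theorem abs_cutoff_le_one (a : Euc N) (r : ℝ) (x : Euc N) : |cutoff a r x| ≤ 1 := by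
  rw [abs_of_nonneg (cutoff_nonneg a r x)]
  exact cutoff_le_one a r x

theorem continuous_cutoff (a : Euc N) (r : ℝ) : Continuous (cutoff a r) := by
  unfold cutoff
  fun_prop

theorem cutoff_eq_one {a : Euc N} {r : ℝ} (hr : 0 < r) {x : Euc N} (hx : x ∈ Metric.ball a r) :
    cutoff a r x = 1 := by
  rw [mem_ball_iff_norm] at hx
  have : ‖x - a‖ / r ≤ 1 := (div_le_one hr).mpr hx.le
  rw [cutoff, min_eq_left (by linarith), max_eq_right zero_le_one]

theorem cutoff_eq_zero {a : Euc N} {r : ℝ} (hr : 0 < r) {x : Euc N}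
    (hx : x ∉ Metric.ball a (2 * r)) : cutoff a r x = 0 := by
  rw [mem_ball_iff_norm, not_lt] at hx
  have : 2 ≤ ‖x - a‖ / r := (le_div_iff₀ hr).mpr hx
  rw [cutoff, max_eq_left]
  exact (min_le_right _ _).trans (by linarith)

theorem abs_cutoff_sub_le (a : Euc N) {r : ℝ} (hr : 0 < r) (x y : Euc N) :
    |cutoff a r x - cutoff a r y| ≤ 1 / r * ‖x - y‖ := by
  have h1 : |cutoff a r x - cutoff a r y| ≤ |(2 - ‖x - a‖ / r) - (2 - ‖y - a‖ / r)| := by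
    unfold cutoff
    refine (abs_max_sub_max_le_max _ _ _ _).trans (max_le (by simp) ?_)
    exact (abs_min_sub_min_le_max _ _ _ _).trans (max_le (by simp) le_rfl)
  refine h1.trans ?_
  have h2 : (2 - ‖x - a‖ / r) - (2 - ‖y - a‖ / r) = 1 / r * (‖y - a‖ - ‖x - a‖) := by ring
  rw [h2, abs_mul, abs_of_pos (by positivity : 0 < 1 / r)]
  refine mul_le_mul_of_nonneg_left ?_ (by positivity)
  refine (abs_norm_sub_norm_le _ _).trans (le_of_eq ?_)
  rw [sub_sub_sub_cancel_right, norm_sub_rev]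

theorem memX0_cutoff (hN : N ≠ 0) (hs0 : 0 < s) (hs1 : s < 1) {a : Euc N} {r : ℝ} (hr : 0 < r)
    (hΩ : Metric.ball a (2 * r) ⊆ Ω) : MemX0 s Ω (cutoff a r) := by
  have hB : MeasurableSet (Metric.ball a (2 * r)) := Metric.isOpen_ball.measurableSet
  have hBf : volume (Metric.ball a (2 * r)) ≠ ⊤ := measure_ball_lt_top.ne
  refine .of_memLp ?_ (memLp_diffQuot_of_lipschitz hN hs0 hs1 (continuous_cutoff a r)
    (abs_cutoff_sub_le a hr) (abs_cutoff_le_one a r) hB hBf fun x hx => cutoff_eq_zero hr hx)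
    (ae_of_all _ fun x hx => cutoff_eq_zero hr fun h => hx (hΩ h))
  refine (memLp_indicator_const 2 hB (1 : ℝ) (Or.inr hBf)).mono
    (continuous_cutoff a r).aestronglyMeasurable (ae_of_all _ fun x => ?_)
  by_cases hx : x ∈ Metric.ball a (2 * r)
  · rw [Set.indicator_of_mem hx, norm_one]
    exact abs_cutoff_le_one a r x
  · rw [cutoff_eq_zero hr hx, norm_zero]
    exact norm_nonneg _

end Bump

/-! ### Subsequences in `L²` and Jensen's inequality. -/

section Abstract

variable {α : Type*} [MeasurableSpace α] {μ : Measure α}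

/-- A sequence that is Cauchy in `L²` has a subsequence converging almost everywhere. -/
theorem exists_subseq_tendsto_ae_of_cauchy {w : ℕ → α → ℝ} (hw : ∀ k, MemLp (w k) 2 μ)
    (hc : ∀ ε : ℝ≥0∞, 0 < ε → ∃ K, ∀ m, K ≤ m → ∀ n, K ≤ n → eLpNorm (w m - w n) 2 μ < ε) :
    ∃ ns : ℕ → ℕ, StrictMono ns ∧ ∃ g : α → ℝ,
      ∀ᵐ x ∂μ, Tendsto (fun n => w (ns n) x) atTop (𝓝 (g x)) := by
  have hC : CauchySeq (fun k => (hw k).toLp (w k)) := by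
    rw [EMetric.cauchySeq_iff]
    simpa only [Lp.edist_toLp_toLp] using hc
  obtain ⟨g, hg⟩ := cauchySeq_tendsto_of_complete hC
  obtain ⟨ns, hns, hlim⟩ := (tendstoInMeasure_of_tendsto_Lp hg).exists_seq_tendsto_ae
  refine ⟨ns, hns, g, ?_⟩
  filter_upwards [hlim, ae_all_iff.mpr fun k => (hw k).coeFn_toLp] with x h1 h2
  simpa only [h2] using h1

/-- A bounded sequence in `L²` has a subsequence whose integrals over all sets of finite measure
converge. -/
theorem exists_subseq_tendsto_setIntegral [IsSeparable μ] {w : ℕ → α → ℝ}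
    (hw : ∀ k, MemLp (w k) 2 μ) {C : ℝ} (hC : ∀ k, eLpNorm (w k) 2 μ ≤ ENNReal.ofReal C) :
    ∃ ns : ℕ → ℕ, StrictMono ns ∧ ∀ S : Set α, MeasurableSet S → μ S ≠ ⊤ →
      ∃ l : ℝ, Tendsto (fun n => ∫ x in S, w (ns n) x ∂μ) atTop (𝓝 l) := by
  have : Fact ((2 : ℝ≥0∞) ≠ ⊤) := ⟨by simp⟩
  let W : ℕ → WeakDual ℝ (Lp ℝ 2 μ) := fun k =>
    StrongDual.toWeakDual (InnerProductSpace.toDual ℝ (Lp ℝ 2 μ) ((hw k).toLp (w k)))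
  have hW : ∀ k, W k ∈ WeakDual.toStrongDual ⁻¹'
      Metric.closedBall (0 : StrongDual ℝ (Lp ℝ 2 μ)) (max C 0) := by
    intro k
    simp only [W, Set.mem_preimage, mem_closedBall_zero_iff]
    change ‖InnerProductSpace.toDual ℝ (Lp ℝ 2 μ) ((hw k).toLp (w k))‖ ≤ _
    rw [LinearIsometryEquiv.norm_map, Lp.norm_toLp]
    refine ENNReal.toReal_le_of_le_ofReal (le_max_right _ _) ((hC k).trans ?_)
    exact ENNReal.ofReal_le_ofReal (le_max_left _ _)
  -- After the Riesz identification this is sequential Banach–Alaoglu in a separable `L²`; testing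
  -- against indicators gives the set integrals.
  obtain ⟨ψ, -, ns, hns, hlim⟩ := WeakDual.isSeqCompact_closedBall ℝ (Lp ℝ 2 μ) 0 (max C 0) hW
  refine ⟨ns, hns, fun S hS hSf => ⟨ψ (indicatorConstLp 2 hS hSf 1), ?_⟩⟩
  have h := tendsto_iff_forall_eval_tendsto_topDualPairing.mp hlim (indicatorConstLp 2 hS hSf 1)
  refine h.congr fun n => ?_
  change inner ℝ ((hw (ns n)).toLp (w (ns n))) (indicatorConstLp 2 hS hSf 1) = _
  rw [real_inner_comm, L2.inner_indicatorConstLp_one]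
  exact integral_congr_ae (ae_restrict_of_ae (hw (ns n)).coeFn_toLp)

theorem enorm_sub_integral_sq_le [IsProbabilityMeasure μ] {v : α → ℝ} (hv : Integrable v μ)
    (c : ℝ) : ‖c - ∫ y, v y ∂μ‖ₑ ^ 2 ≤ ∫⁻ y, ‖c - v y‖ₑ ^ 2 ∂μ := by
  have hm : AEStronglyMeasurable (fun y => c - v y) μ := aestronglyMeasurable_const.sub hv.1
  have h1 : c - ∫ y, v y ∂μ = ∫ y, (c - v y) ∂μ := by
    rw [integral_sub (integrable_const c) hv]
    simp
  have h2 : ‖∫ y, (c - v y) ∂μ‖ₑ ≤ eLpNorm (fun y => c - v y) 2 μ := by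
    refine (enorm_integral_le_lintegral_enorm _).trans ?_
    rw [← eLpNorm_one_eq_lintegral_enorm]
    exact eLpNorm_le_eLpNorm_of_exponent_le (by norm_num) hm
  rw [h1]
  refine (pow_le_pow_left' h2 2).trans (le_of_eq ?_)
  rw [eLpNorm_eq_lintegral_rpow_enorm_toReal (by simp) (by simp), ← ENNReal.rpow_natCast,
    ← ENNReal.rpow_mul]
  simp

end Abstract

/-! ### Approximation by ball averages. -/

section Average

variable {N : ℕ} {s : ℝ}

theorem aestronglyMeasurable_ball_average {v : Euc N → ℝ} (hv : AEStronglyMeasurable v volume)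
    (r : ℝ) : AEStronglyMeasurable (fun x => ⨍ y in Metric.ball x r, v y) volume := by
  have hset : MeasurableSet {z : Euc N × Euc N | dist z.2 z.1 < r} :=
    measurableSet_lt (by fun_prop) measurable_const
  have h1 : AEStronglyMeasurable (fun z : Euc N × Euc N => v z.2) volume :=
    hv.comp_quasiMeasurePreserving Measure.quasiMeasurePreserving_snd
  have h2 := (h1.indicator hset).integral_prod_right'
  refine (h2.const_mul (volume.real (Metric.ball (0 : Euc N) r))⁻¹).congr
    (ae_of_all _ fun x => ?_)
  simp only
  rw [setAverage_eq, smul_eq_mul, measureReal_def, measureReal_def,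
    Measure.addHaar_ball_center volume x r, ← integral_indicator Metric.isOpen_ball.measurableSet]
  rfl

theorem enorm_sub_sq_le_diffQuot (hs0 : 0 < s) {r : ℝ} (v : Euc N → ℝ) {x y : Euc N}
    (hy : y ∈ Metric.ball x r) :
    ‖v x - v y‖ₑ ^ 2 ≤ ENNReal.ofReal (r ^ ((N : ℝ) + 2 * s)) * ‖diffQuot s v (x, y)‖ₑ ^ 2 := by
  rw [← enorm_pow, ← enorm_pow, Real.enorm_eq_ofReal (sq_nonneg _),
    Real.enorm_eq_ofReal (sq_nonneg _), ← ENNReal.ofReal_mul' (sq_nonneg _)]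
  refine ENNReal.ofReal_le_ofReal ?_
  by_cases hxy : x = y
  · subst hxy
    simp [diffQuot]
  have hpos : 0 < ‖x - y‖ := norm_pos_iff.mpr (sub_ne_zero.mpr hxy)
  rw [Metric.mem_ball_comm, mem_ball_iff_norm] at hy
  rw [sq (diffQuot s v (x, y)), diffQuot_mul_diffQuot, ← sq, ← mul_div_assoc, mul_comm,
    le_div_iff₀ (by positivity)]
  refine mul_le_mul_of_nonneg_left ?_ (sq_nonneg _)
  exact Real.rpow_le_rpow hpos.le hy.le (by positivity)

/-- The distance in `L²` of a function from its averages over balls of radius `r` is `O(r^s)`. -/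
theorem lintegral_sub_ball_average_le (hN : N ≠ 0) (hs0 : 0 < s) {v : Euc N → ℝ}
    (hv : Integrable v) {r : ℝ} (hr : 0 < r) :
    ∫⁻ x, ‖v x - ⨍ y in Metric.ball x r, v y‖ₑ ^ 2 ≤
      ENNReal.ofReal (r ^ (2 * s)) * (volume (Metric.ball (0 : Euc N) 1))⁻¹ *
        gagliardoNorm s v ^ 2 := by
  have : Nonempty (Fin N) := ⟨⟨0, Nat.pos_of_ne_zero hN⟩⟩
  have hvol : ∀ x : Euc N, volume (Metric.ball x r) =
      ENNReal.ofReal (r ^ N) * volume (Metric.ball (0 : Euc N) 1) := fun x => by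
    rw [Measure.addHaar_ball volume x hr.le, finrank_euclideanSpace_fin]
  -- Jensen bounds the left side by the mean of `|v x - v y|²` over the ball, where `|x - y| < r`
  -- allows the kernel to be inserted at the cost of `r ^ (N + 2s)`. Dividing by the volume leaves
  -- `r ^ (2s)`.
  have hpt : ∀ x, ‖v x - ⨍ y in Metric.ball x r, v y‖ₑ ^ 2 ≤
      (ENNReal.ofReal (r ^ N) * volume (Metric.ball (0 : Euc N) 1))⁻¹ *
        (ENNReal.ofReal (r ^ ((N : ℝ) + 2 * s)) * ∫⁻ y, ‖diffQuot s v (x, y)‖ₑ ^ 2) := by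
    intro x
    have hfin : IsFiniteMeasure (volume.restrict (Metric.ball x r)) :=
      ⟨by rw [Measure.restrict_apply_univ]; exact measure_ball_lt_top⟩
    have hne : NeZero (volume.restrict (Metric.ball x r)) := ⟨by
      rw [Ne, Measure.restrict_eq_zero]
      exact (Metric.measure_ball_pos volume x hr).ne'⟩
    refine (enorm_sub_integral_sq_le (hv.restrict.to_average) (v x)).trans ?_
    rw [lintegral_smul_measure, Measure.restrict_apply_univ, hvol, smul_eq_mul]
    refine mul_le_mul_right ?_ _
    rw [← lintegral_const_mul' _ _ ENNReal.ofReal_ne_top]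
    refine le_trans ?_ (setLIntegral_le_lintegral (Metric.ball x r) _)
    exact setLIntegral_mono' Metric.isOpen_ball.measurableSet fun y hy =>
      enorm_sub_sq_le_diffQuot hs0 v hy
  have hD := aestronglyMeasurable_diffQuot (s := s) hv.1
  have hnorm : gagliardoNorm s v ^ 2 = ∫⁻ x, ∫⁻ y, ‖diffQuot s v (x, y)‖ₑ ^ 2 := by
    rw [gagliardoNorm_eq, eLpNorm_eq_lintegral_rpow_enorm_toReal (by simp) (by simp),
      ← ENNReal.rpow_natCast, ← ENNReal.rpow_mul]
    simp only [ENNReal.toReal_ofNat, Nat.cast_ofNat, ENNReal.rpow_ofNat, one_div]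
    rw [inv_mul_cancel₀ two_ne_zero, ENNReal.rpow_one]
    exact lintegral_prod _ (hD.enorm.pow_const 2)
  refine (lintegral_mono hpt).trans ?_
  have hvol1 : volume (Metric.ball (0 : Euc N) 1) ≠ 0 :=
    (Metric.measure_ball_pos volume 0 one_pos).ne'
  have hvolt : volume (Metric.ball (0 : Euc N) 1) ≠ ⊤ := measure_ball_lt_top.ne
  have hrN : ENNReal.ofReal (r ^ N) ≠ 0 := by
    rw [Ne, ENNReal.ofReal_eq_zero, not_le]
    positivity
  rw [lintegral_const_mul' _ _ (ENNReal.inv_ne_top.mpr (mul_ne_zero hrN hvol1)),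
    lintegral_const_mul' _ _ ENNReal.ofReal_ne_top, ← hnorm,
    ENNReal.mul_inv (Or.inl hrN) (Or.inl ENNReal.ofReal_ne_top), Real.rpow_add hr,
    Real.rpow_natCast, ENNReal.ofReal_mul (by positivity)]
  refine le_of_eq ?_
  calc (ENNReal.ofReal (r ^ N))⁻¹ * (volume (Metric.ball (0 : Euc N) 1))⁻¹ *
        (ENNReal.ofReal (r ^ N) * ENNReal.ofReal (r ^ (2 * s)) * gagliardoNorm s v ^ 2)
      = ((ENNReal.ofReal (r ^ N))⁻¹ * ENNReal.ofReal (r ^ N)) * (ENNReal.ofReal (r ^ (2 * s)) *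
          (volume (Metric.ball (0 : Euc N) 1))⁻¹ * gagliardoNorm s v ^ 2) := by ring
    _ = _ := by rw [ENNReal.inv_mul_cancel hrN ENNReal.ofReal_ne_top, one_mul]

theorem eLpNorm_two_eq {α : Type*} [MeasurableSpace α] {μ : Measure α} (g : α → ℝ) :
    eLpNorm g 2 μ = (∫⁻ x, ‖g x‖ₑ ^ 2 ∂μ) ^ (1 / 2 : ℝ) := by
  rw [eLpNorm_eq_lintegral_rpow_enorm_toReal (by simp) (by simp)]
  simp

/-- The radius depends only on the seminorm bound, so one radius serves a whole bounded sequence. -/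
theorem exists_radius_forall_eLpNorm_sub_average_le (hN : N ≠ 0) (hs0 : 0 < s) {M : ℝ≥0∞}
    (hM : M ≠ ⊤) {ε : ℝ≥0∞} (hε : 0 < ε) : ∃ r : ℝ, 0 < r ∧ ∀ v : Euc N → ℝ, Integrable v →
      gagliardoNorm s v ≤ M →
      eLpNorm (fun x => v x - ⨍ y in Metric.ball x r, v y) 2 volume < ε := by
  have hvol1 : volume (Metric.ball (0 : Euc N) 1) ≠ 0 :=
    (Metric.measure_ball_pos volume 0 one_pos).ne'
  have hlim : Tendsto (fun r : ℝ => (ENNReal.ofReal (r ^ (2 * s)) *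
      (volume (Metric.ball (0 : Euc N) 1))⁻¹ * M ^ 2) ^ (1 / 2 : ℝ)) (𝓝[>] 0) (𝓝 0) := by
    have h1 : Tendsto (fun r : ℝ => r ^ (2 * s)) (𝓝[>] 0) (𝓝 0) := by
      have : ContinuousAt (fun r : ℝ => r ^ (2 * s)) 0 :=
        Real.continuousAt_rpow_const _ _ (Or.inr (by positivity))
      have h := this.tendsto
      rw [Real.zero_rpow (by positivity)] at h
      exact h.mono_left nhdsWithin_le_nhds
    have h2 := ENNReal.tendsto_ofReal h1
    rw [ENNReal.ofReal_zero] at h2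
    have h3 := ENNReal.Tendsto.mul_const (b := (volume (Metric.ball (0 : Euc N) 1))⁻¹) h2
      (Or.inr (ENNReal.inv_ne_top.mpr hvol1))
    have h4 := ENNReal.Tendsto.mul_const (b := M ^ 2) h3 (Or.inr (ENNReal.pow_ne_top hM))
    have h5 := h4.ennrpow_const (1 / 2 : ℝ)
    simpa using h5
  obtain ⟨r, hr, hr0⟩ := ((hlim.eventually_lt_const hε).and self_mem_nhdsWithin).exists
  refine ⟨r, hr0, fun v hv hvM => lt_of_le_of_lt ?_ hr⟩
  rw [eLpNorm_two_eq]
  refine ENNReal.rpow_le_rpow ?_ (by norm_num)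
  refine (lintegral_sub_ball_average_le hN hs0 hv hr0).trans ?_
  gcongr

end Average

/-! ### Compact embedding. -/

section Compactness

variable {N : ℕ} {s : ℝ} {Ω : Set (Euc N)}

theorem abs_ball_average_le {v : Euc N → ℝ} {d : ℝ} (hd : ∀ x, |v x| ≤ d) {r : ℝ} (hr : 0 < r)
    (x : Euc N) : |⨍ y in Metric.ball x r, v y| ≤ d := by
  have hpos : 0 < volume.real (Metric.ball x r) :=
    ENNReal.toReal_pos (Metric.measure_ball_pos volume x hr).ne' measure_ball_lt_top.ne
  have h := norm_setIntegral_le_of_norm_le_const (μ := volume) (f := v) (s := Metric.ball x r)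
    measure_ball_lt_top fun y _ => (hd y : ‖v y‖ ≤ d)
  rw [setAverage_eq, smul_eq_mul, abs_mul, abs_of_pos (inv_pos.mpr hpos), inv_mul_le_iff₀ hpos,
    mul_comm]
  exact h

/-- Compactness of the embedding of `X_0^s`: a uniformly bounded sequence with bounded Gagliardo
seminorms, supported in a set of finite measure, has a subsequence converging almost everywhere. -/
theorem exists_subseq_tendsto_ae (hN : N ≠ 0) (hs0 : 0 < s) (hΩ : MeasurableSet Ω)
    (hΩf : volume Ω ≠ ⊤) {w : ℕ → Euc N → ℝ} {d : ℝ} {M : ℝ≥0∞} (hM : M ≠ ⊤)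
    (hw : ∀ k, AEStronglyMeasurable (w k) volume) (hd : ∀ k x, |w k x| ≤ d)
    (hw0 : ∀ k, ∀ᵐ x, x ∉ Ω → w k x = 0) (hwM : ∀ k, gagliardoNorm s (w k) ≤ M) :
    ∃ ns : ℕ → ℕ, StrictMono ns ∧ ∃ g : Euc N → ℝ,
      ∀ᵐ x, Tendsto (fun n => w (ns n) x) atTop (𝓝 (g x)) := by
  have hind : ∀ p : ℝ≥0∞, ∀ k, MemLp (w k) p volume := fun p k => by
    refine (memLp_indicator_const p hΩ d (Or.inr hΩf)).mono (hw k) ?_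
    filter_upwards [hw0 k] with x h0
    by_cases hx : x ∈ Ω
    · rw [Set.indicator_of_mem hx]
      exact (hd k x).trans (le_abs_self d)
    · rw [h0 hx, norm_zero]
      exact norm_nonneg _
  have hint : ∀ k, Integrable (w k) := fun k => memLp_one_iff_integrable.mp (hind 1 k)
  have hbd : ∀ k, eLpNorm (w k) 2 volume ≤
      ENNReal.ofReal (eLpNorm (Ω.indicator fun _ => d) 2 volume).toReal := fun k => by
    rw [ENNReal.ofReal_toReal (memLp_indicator_const 2 hΩ d (Or.inr hΩf)).2.ne]
    refine eLpNorm_mono_ae ?_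
    filter_upwards [hw0 k] with x h0
    by_cases hx : x ∈ Ω
    · rw [Set.indicator_of_mem hx]
      exact (hd k x).trans (le_abs_self d)
    · rw [h0 hx, norm_zero]
      exact norm_nonneg _
  obtain ⟨ns, hns, hlim⟩ := exists_subseq_tendsto_setIntegral (hind 2) hbd
  have hfin : IsFiniteMeasure (volume.restrict Ω) :=
    ⟨by rw [Measure.restrict_apply_univ]; exact hΩf.lt_top⟩
  -- At a fixed radius the averages converge pointwise, by convergence of integrals over balls, and
  -- are bounded by `d`, hence converge in `L²(Ω)`. The sequence is uniformly close to its averages,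
  -- so it is Cauchy there.
  have hcauchy : ∀ ε : ℝ≥0∞, 0 < ε → ∃ K, ∀ m, K ≤ m → ∀ n, K ≤ n →
      eLpNorm (w (ns m) - w (ns n)) 2 (volume.restrict Ω) < ε := by
    intro ε hε
    have hε4 : 0 < ε / 4 := ENNReal.div_pos hε.ne' (by simp)
    obtain ⟨r, hr, hrv⟩ := exists_radius_forall_eLpNorm_sub_average_le (N := N) hN hs0 hM hε4
    set A : ℕ → Euc N → ℝ := fun k x => ⨍ y in Metric.ball x r, w (ns k) y with hA
    have hAm : ∀ k, AEStronglyMeasurable (A k) (volume.restrict Ω) := fun k =>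
      (aestronglyMeasurable_ball_average (hw (ns k)) r).restrict
    have hAl : ∀ x, ∃ l, Tendsto (fun k => A k x) atTop (𝓝 l) := fun x => by
      obtain ⟨l, hl⟩ := hlim (Metric.ball x r) Metric.isOpen_ball.measurableSet
        measure_ball_lt_top.ne
      refine ⟨(volume.real (Metric.ball x r))⁻¹ * l, ?_⟩
      simp only [hA, setAverage_eq, smul_eq_mul]
      exact hl.const_mul _
    choose G hG using hAl
    have hGm : AEStronglyMeasurable G (volume.restrict Ω) :=
      aestronglyMeasurable_of_tendsto_ae atTop hAm (ae_of_all _ hG)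
    have hAG : Tendsto (fun k => eLpNorm (fun x => A k x - G x) 2 (volume.restrict Ω)) atTop
        (𝓝 0) := by
      simp only [eLpNorm_two_eq]
      have hAd : ∀ k x, |A k x| ≤ d := fun k x => abs_ball_average_le (hd (ns k)) hr x
      have hGd : ∀ x, |G x| ≤ d := fun x => le_of_tendsto' (hG x).abs fun k => hAd k x
      have h := tendsto_lintegral_of_dominated_convergence' (μ := volume.restrict Ω)
        (F := fun k x => ‖A k x - G x‖ₑ ^ 2) (f := fun _ => 0)
        (fun _ => ENNReal.ofReal ((2 * d) ^ 2))
        (fun k => ((hAm k).sub hGm).enorm.pow_const 2)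
        (fun k => ae_of_all _ fun x => by
          simp only
          rw [← enorm_pow, Real.enorm_eq_ofReal (sq_nonneg _), ← sq_abs]
          refine ENNReal.ofReal_le_ofReal (pow_le_pow_left₀ (abs_nonneg _) ?_ 2)
          linarith [abs_sub (A k x) (G x), hAd k x, hGd x])
        (by
          rw [lintegral_const]
          exact ENNReal.mul_ne_top ENNReal.ofReal_ne_top (measure_ne_top _ _))
        (ae_of_all _ fun x => by
          have h1 : Tendsto (fun k => A k x - G x) atTop (𝓝 0) := by
            simpa using (hG x).sub_const (G x)
          have h2 := h1.enorm
          rw [enorm_zero] at h2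
          simpa using ENNReal.Tendsto.pow (n := 2) h2)
      rw [lintegral_zero] at h
      have h2 := h.ennrpow_const (1 / 2 : ℝ)
      simpa using h2
    obtain ⟨K, hK⟩ := eventually_atTop.mp (hAG.eventually_lt_const hε4)
    refine ⟨K, fun m hm n hn => ?_⟩
    have hwA : ∀ k, eLpNorm (fun x => w (ns k) x - A k x) 2 (volume.restrict Ω) < ε / 4 :=
      fun k => (eLpNorm_mono_measure _ Measure.restrict_le_self).trans_lt
        (hrv _ (hint (ns k)) (hwM (ns k)))
    have hwG : ∀ k, K ≤ k →
        eLpNorm (fun x => w (ns k) x - G x) 2 (volume.restrict Ω) < ε / 2 := fun k hk => by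
      have e : (fun x => w (ns k) x - G x) =
          (fun x => w (ns k) x - A k x) + (fun x => A k x - G x) := by
        ext x
        simp
      rw [e]
      refine (eLpNorm_add_le ((hw (ns k)).restrict.sub (hAm k)) ((hAm k).sub hGm)
        (by norm_num)).trans_lt ?_
      refine (ENNReal.add_lt_add (hwA k) (hK k hk)).trans_le (le_of_eq ?_)
      have e4 : ε / 4 = ε / 2 / 2 := by
        rw [ENNReal.div_eq_inv_mul, ENNReal.div_eq_inv_mul, ENNReal.div_eq_inv_mul, ← mul_assoc,
          ← ENNReal.mul_inv (by simp) (by simp)]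
        norm_num
      rw [e4, ENNReal.add_halves]
    have e : w (ns m) - w (ns n) =
        (fun x => w (ns m) x - G x) - (fun x => w (ns n) x - G x) := by
      ext x
      simp
    rw [e]
    refine (eLpNorm_sub_le ((hw (ns m)).restrict.sub hGm) ((hw (ns n)).restrict.sub hGm)
      (by norm_num)).trans_lt ?_
    exact (ENNReal.add_lt_add (hwG m hm) (hwG n hn)).trans_le (ENNReal.add_halves ε).le
  obtain ⟨ms, hms, g, hg⟩ := exists_subseq_tendsto_ae_of_cauchy
    (fun k => (hind 2 (ns k)).restrict Ω) hcauchy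
  refine ⟨ns ∘ ms, hns.comp hms, Ω.indicator g, ?_⟩
  filter_upwards [(ae_restrict_iff' hΩ).mp hg, ae_all_iff.mpr hw0] with x hx h0
  by_cases hxΩ : x ∈ Ω
  · rw [Set.indicator_of_mem hxΩ]
    exact hx hxΩ
  · rw [Set.indicator_of_notMem hxΩ]
    exact tendsto_const_nhds.congr fun n => (h0 _ hxΩ).symm

end Compactness

/-! ### The direct method for a bounded reaction. -/

/-- The primitive of `h` vanishing at the origin. -/
noncomputable def primitive (h : ℝ → ℝ) (t : ℝ) : ℝ := ∫ τ in (0 : ℝ)..t, h τ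

/-- The energy functional whose critical points are the weak solutions of `(-Δ)^s u = h(u)`. -/
noncomputable def energy {N : ℕ} (s : ℝ) (Ω : Set (Euc N)) (h : ℝ → ℝ) (v : Euc N → ℝ) : ℝ :=
  gagliardoForm s v v / 2 - ∫ x in Ω, primitive h (v x)

/-- The projection of the real line to the interval `[0, d]`. -/
def clamp (d t : ℝ) : ℝ := max 0 (min d t)

section Clamp

variable {d : ℝ}

theorem continuous_clamp (d : ℝ) : Continuous (clamp d) := by
  unfold clamp
  fun_prop

theorem abs_clamp_sub_le (d a b : ℝ) : |clamp d a - clamp d b| ≤ |a - b| := by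
  unfold clamp
  refine (abs_max_sub_max_le_max _ _ _ _).trans (max_le (by simp) ?_)
  exact (abs_min_sub_min_le_max _ _ _ _).trans (max_le (by simp) le_rfl)

theorem clamp_nonneg (d t : ℝ) : 0 ≤ clamp d t := le_max_left _ _

theorem clamp_le (hd : 0 ≤ d) (t : ℝ) : clamp d t ≤ d := max_le hd (min_le_left _ _)

theorem clamp_of_mem {t : ℝ} (h0 : 0 ≤ t) (hd : t ≤ d) : clamp d t = t := by
  rw [clamp, min_eq_right hd, max_eq_right h0]

theorem clamp_of_nonpos (hd : 0 ≤ d) {t : ℝ} (h : t ≤ 0) : clamp d t = 0 := by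
  rw [clamp, min_eq_right (h.trans hd), max_eq_left h]

theorem clamp_of_ge (hd : 0 ≤ d) {t : ℝ} (h : d ≤ t) : clamp d t = d := by
  rw [clamp, min_eq_left h, max_eq_right hd]

end Clamp

section Primitive

variable {h : ℝ → ℝ} {d B : ℝ}

theorem hasDerivAt_primitive (hc : Continuous h) (t : ℝ) : HasDerivAt (primitive h) (h t) t :=
  intervalIntegral.integral_hasDerivAt_right (hc.intervalIntegrable _ _)
    (hc.stronglyMeasurableAtFilter _ _) hc.continuousAt

theorem continuous_primitive (hc : Continuous h) : Continuous (primitive h) :=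
  continuous_iff_continuousAt.mpr fun t => (hasDerivAt_primitive hc t).continuousAt

theorem abs_primitive_le (hB : ∀ t, |h t| ≤ B) (t : ℝ) : |primitive h t| ≤ B * |t| := by
  have := intervalIntegral.norm_integral_le_of_norm_le_const (f := h) (a := 0) (b := t) (C := B)
    fun x _ => hB x
  rwa [sub_zero] at this

theorem primitive_zero (h : ℝ → ℝ) : primitive h 0 = 0 := intervalIntegral.integral_same

/-- The primitive is constant on the negative axis and nonincreasing beyond `d`. -/
theorem primitive_le_primitive_clamp (hc : Continuous h) (hd : 0 ≤ d)
    (hneg : ∀ t, t ≤ 0 → h t = 0) (hpos : ∀ t, d ≤ t → h t ≤ 0) (t : ℝ) :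
    primitive h t ≤ primitive h (clamp d t) := by
  rcases le_total t 0 with h0 | h0
  · rw [clamp_of_nonpos hd h0, primitive_zero, primitive, intervalIntegral.integral_symm]
    refine neg_nonpos.mpr (intervalIntegral.integral_nonneg h0 fun x hx => ?_)
    rw [hneg x hx.2]
  rcases le_total t d with h1 | h1
  · rw [clamp_of_mem h0 h1]
  · rw [clamp_of_ge hd h1, primitive, primitive,
      ← intervalIntegral.integral_add_adjacent_intervals (hc.intervalIntegrable 0 d)
        (hc.intervalIntegrable d t)]
    have : 0 ≤ ∫ τ in d..t, -h τ :=
      intervalIntegral.integral_nonneg h1 fun x hx => neg_nonneg.mpr (hpos x hx.1)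
    rw [intervalIntegral.integral_neg] at this
    linarith

end Primitive

section Minimization

variable {N : ℕ} {s : ℝ} {Ω : Set (Euc N)} {h : ℝ → ℝ} {d B : ℝ} {u φ : Euc N → ℝ}

theorem MemX0.integrableOn (hΩf : volume Ω ≠ ⊤) (hu : MemX0 s Ω u) : IntegrableOn u Ω := by
  have hfin : IsFiniteMeasure (volume.restrict Ω) :=
    ⟨by rw [Measure.restrict_apply_univ]; exact hΩf.lt_top⟩
  exact (hu.memLp.restrict Ω).integrable (by norm_num)

theorem integrableOn_primitive (hΩf : volume Ω ≠ ⊤) (hc : Continuous h) (hB : ∀ t, |h t| ≤ B)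
    (hu : MemX0 s Ω u) : IntegrableOn (fun x => primitive h (u x)) Ω := by
  refine ((hu.integrableOn hΩf).norm.const_mul B).mono'
    ((continuous_primitive hc).comp_aestronglyMeasurable hu.memLp.1.restrict)
    (ae_of_all _ fun x => abs_primitive_le hB (u x))

theorem memX0_of_bounded (hΩ : MeasurableSet Ω) (hΩf : volume Ω ≠ ⊤)
    (hm : AEStronglyMeasurable u volume) (hd : ∀ x, |u x| ≤ d) (h0 : ∀ᵐ x, x ∉ Ω → u x = 0)
    (hn : gagliardoNorm s u < ⊤) : MemX0 s Ω u := by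
  refine ⟨(memLp_indicator_const 2 hΩ d (Or.inr hΩf)).mono hm ?_, hn, h0⟩
  filter_upwards [h0] with x hx
  by_cases hxΩ : x ∈ Ω
  · rw [Set.indicator_of_mem hxΩ]
    exact (hd x).trans (le_abs_self d)
  · rw [hx hxΩ, norm_zero]
    exact norm_nonneg _

/-- Fatou's lemma for the difference quotients, which converge almost everywhere on the product
space. -/
theorem gagliardoNorm_le_of_tendsto {w : ℕ → Euc N → ℝ} {c : ℝ≥0∞}
    (hw : ∀ k, AEStronglyMeasurable (w k) volume)
    (hu : ∀ᵐ x, Tendsto (fun k => w k x) atTop (𝓝 (u x)))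
    (hc : Tendsto (fun k => gagliardoNorm s (w k)) atTop (𝓝 c)) : gagliardoNorm s u ≤ c := by
  simp only [gagliardoNorm_eq] at hc ⊢
  rw [← hc.liminf_eq]
  refine Lp.eLpNorm_lim_le_liminf_eLpNorm
    (fun k => aestronglyMeasurable_diffQuot (hw k)) _ ?_
  have h1 : ∀ᵐ z : Euc N × Euc N, Tendsto (fun k => w k z.1) atTop (𝓝 (u z.1)) :=
    Measure.quasiMeasurePreserving_fst.ae hu
  have h2 : ∀ᵐ z : Euc N × Euc N, Tendsto (fun k => w k z.2) atTop (𝓝 (u z.2)) :=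
    Measure.quasiMeasurePreserving_snd.ae hu
  filter_upwards [h1, h2] with z hz1 hz2
  exact (hz1.sub hz2).div_const _

theorem energy_clamp_le (hΩf : volume Ω ≠ ⊤) (hd : 0 ≤ d) (hc : Continuous h)
    (hB : ∀ t, |h t| ≤ B) (hneg : ∀ t, t ≤ 0 → h t = 0) (hpos : ∀ t, d ≤ t → h t ≤ 0)
    (hu : MemX0 s Ω u) : energy s Ω h (fun x => clamp d (u x)) ≤ energy s Ω h u := by
  have hcl := hu.comp (continuous_clamp d) (C := 1) (by simpa using abs_clamp_sub_le d)
    (clamp_of_nonpos hd le_rfl)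
  have h1 := gagliardoForm_comp_le (continuous_clamp d) (abs_clamp_sub_le d)
    (clamp_of_nonpos hd le_rfl) hu
  have h2 := setIntegral_mono (integrableOn_primitive hΩf hc hB hu)
    (integrableOn_primitive hΩf hc hB hcl)
    fun x => primitive_le_primitive_clamp hc hd hneg hpos (u x)
  unfold energy
  linarith

theorem setIntegral_primitive_le (hΩf : volume Ω ≠ ⊤)
    (hB : ∀ t, |h t| ≤ B) (hu : ∀ x, |u x| ≤ d) :
    ∫ x in Ω, primitive h (u x) ≤ B * d * volume.real Ω := by
  refine (Real.le_norm_self _).trans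
    (norm_setIntegral_le_of_norm_le_const hΩf.lt_top fun x _ => ?_)
  exact (abs_primitive_le hB (u x)).trans
    (mul_le_mul_of_nonneg_left (hu x) ((abs_nonneg _).trans (hB 0)))

/-- The energy attains its minimum over `X_0^s` at a function with values in `[0, d]`. -/
theorem exists_minimizer (hN : N ≠ 0) (hs0 : 0 < s) (hΩ : MeasurableSet Ω) (hΩf : volume Ω ≠ ⊤)
    (hd : 0 ≤ d) (hc : Continuous h) (hB : ∀ t, |h t| ≤ B) (hneg : ∀ t, t ≤ 0 → h t = 0)
    (hpos : ∀ t, d ≤ t → h t ≤ 0) :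
    ∃ u, MemX0 s Ω u ∧ (∀ x, 0 ≤ u x) ∧ (∀ x, u x ≤ d) ∧
      ∀ v, MemX0 s Ω v → energy s Ω h u ≤ energy s Ω h v := by
  set W : Set (Euc N → ℝ) := {v | MemX0 s Ω v ∧ (∀ x, 0 ≤ v x) ∧ ∀ x, v x ≤ d} with hW
  have habs : ∀ v ∈ W, ∀ x, |v x| ≤ d := fun v hv x => by
    rw [abs_of_nonneg (hv.2.1 x)]
    exact hv.2.2 x
  have hne : (energy s Ω h '' W).Nonempty :=
    ⟨_, fun _ => 0, ⟨memX0_zero, fun _ => le_rfl, fun _ => hd⟩, rfl⟩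
  have hform : ∀ v ∈ W, gagliardoForm s v v ≤ 2 * (energy s Ω h v + B * d * volume.real Ω) :=
    fun v hv => by
      have := setIntegral_primitive_le hΩf hB (habs v hv)
      unfold energy
      linarith
  have hbdd : BddBelow (energy s Ω h '' W) := by
    refine ⟨-(B * d * volume.real Ω), ?_⟩
    rintro _ ⟨v, hv, rfl⟩
    have h1 := hform v hv
    have h2 := gagliardoForm_self_nonneg (s := s) v
    linarith
  obtain ⟨e, -, he, hemem⟩ := exists_seq_tendsto_sInf hne hbdd
  choose w hwW hwe using hemem
  set m := sInf (energy s Ω h '' W) with hm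
  obtain ⟨C, hC⟩ := he.bddAbove_range
  have hnorm : ∀ k, gagliardoNorm s (w k) ≤
      ENNReal.ofReal (√(2 * (C + B * d * volume.real Ω))) := fun k => by
    rw [gagliardoNorm_eq_ofReal_sqrt (hwW k).1]
    refine ENNReal.ofReal_le_ofReal (Real.sqrt_le_sqrt ((hform _ (hwW k)).trans ?_))
    have : e k ≤ C := hC ⟨k, rfl⟩
    rw [hwe k]
    linarith
  obtain ⟨ns, hns, g, hg⟩ := exists_subseq_tendsto_ae hN hs0 hΩ hΩf ENNReal.ofReal_ne_top
    (fun k => (hwW k).1.memLp.1) (fun k => habs _ (hwW k)) (fun k => (hwW k).1.eq_zero) hnorm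
  -- Clamping changes the limit only on a null set and makes the bounds `0 ≤ u ≤ d` hold everywhere.
  set u : Euc N → ℝ := fun x => clamp d (g x) with hu
  have hlim : ∀ᵐ x, Tendsto (fun n => w (ns n) x) atTop (𝓝 (u x)) := by
    filter_upwards [hg] with x hx
    refine (((continuous_clamp d).tendsto _).comp hx).congr fun n => ?_
    exact clamp_of_mem ((hwW (ns n)).2.1 x) ((hwW (ns n)).2.2 x)
  have hum : AEStronglyMeasurable u volume :=
    aestronglyMeasurable_of_tendsto_ae atTop (fun n => (hwW (ns n)).1.memLp.1) hlim
  have hu0 : ∀ᵐ x, x ∉ Ω → u x = 0 := by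
    filter_upwards [hlim, ae_all_iff.mpr fun k => (hwW k).1.eq_zero] with x hx h0 hxΩ
    exact tendsto_nhds_unique hx (tendsto_const_nhds.congr fun n => (h0 (ns n) hxΩ).symm)
  have huabs : ∀ x, |u x| ≤ d := fun x => by
    rw [abs_of_nonneg (clamp_nonneg _ _)]
    exact clamp_le hd _
  set b := ∫ x in Ω, primitive h (u x) with hb
  have hpot : Tendsto (fun n => ∫ x in Ω, primitive h (w (ns n) x)) atTop (𝓝 b) := by
    refine tendsto_integral_of_dominated_convergence (fun _ => B * d) (fun n => ?_) ?_
      (fun n => ae_of_all _ fun x => ?_) ?_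
    · exact (continuous_primitive hc).comp_aestronglyMeasurable (hwW (ns n)).1.memLp.1.restrict
    · exact integrableOn_const hΩf
    · exact (abs_primitive_le hB _).trans
        (mul_le_mul_of_nonneg_left (habs _ (hwW (ns n)) x) ((abs_nonneg _).trans (hB 0)))
    · filter_upwards [ae_restrict_of_ae hlim] with x hx
      exact ((continuous_primitive hc).tendsto _).comp hx
  -- Energies and potentials both converge, so the quadratic parts do too; semicontinuity then
  -- compares `u` with their limit.
  have hQ : Tendsto (fun n => gagliardoForm s (w (ns n)) (w (ns n))) atTop
      (𝓝 (2 * (m + b))) := by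
    refine (((he.comp hns.tendsto_atTop).add hpot).const_mul 2).congr fun n => ?_
    simp only [Function.comp, ← hwe, energy]
    ring
  have hle : gagliardoNorm s u ≤ ENNReal.ofReal (√(2 * (m + b))) := by
    refine gagliardoNorm_le_of_tendsto (fun n => (hwW (ns n)).1.memLp.1) hlim ?_
    simp only [gagliardoNorm_eq_ofReal_sqrt (hwW _).1]
    exact ENNReal.tendsto_ofReal ((Real.continuous_sqrt.tendsto _).comp hQ)
  have huX : MemX0 s Ω u :=
    memX0_of_bounded hΩ hΩf hum huabs hu0 (hle.trans_lt ENNReal.ofReal_lt_top)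
  have hQu : gagliardoForm s u u ≤ 2 * (m + b) := by
    rw [gagliardoNorm_eq_ofReal_sqrt huX, ENNReal.ofReal_le_ofReal_iff (Real.sqrt_nonneg _)] at hle
    exact (Real.sqrt_le_sqrt_iff
      (ge_of_tendsto' hQ fun n => gagliardoForm_self_nonneg _)).mp hle
  have hum' : energy s Ω h u ≤ m := by
    unfold energy
    linarith
  refine ⟨u, huX, fun x => clamp_nonneg _ _, fun x => clamp_le hd _, fun v hv => ?_⟩
  -- The infimum was taken over functions with values in `[0, d]`; a general competitor is clamped
  -- first.
  refine hum'.trans (le_trans (csInf_le hbdd ⟨fun x => clamp d (v x), ⟨?_, fun x =>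
    clamp_nonneg _ _, fun x => clamp_le hd _⟩, rfl⟩)
    (energy_clamp_le hΩf hd hc hB hneg hpos hv))
  exact hv.comp (continuous_clamp d) (C := 1) (by simpa using abs_clamp_sub_le d)
    (clamp_of_nonpos hd le_rfl)

/-- The Euler–Lagrange equation of the energy functional. -/
theorem gagliardoForm_eq_of_minimizer (hΩf : volume Ω ≠ ⊤) (hc : Continuous h)
    (hB : ∀ t, |h t| ≤ B) (hu : MemX0 s Ω u)
    (hmin : ∀ v, MemX0 s Ω v → energy s Ω h u ≤ energy s Ω h v) (hφ : MemX0 s Ω φ) :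
    gagliardoForm s u φ = ∫ x in Ω, h (u x) * φ x := by
  have hpath : ∀ t : ℝ, MemX0 s Ω (fun x => u x + t * φ x) := fun t => hu.add (hφ.const_mul t)
  have hI : HasDerivAt (fun t : ℝ => ∫ x in Ω, primitive h (u x + t * φ x))
      (∫ x in Ω, h (u x + 0 * φ x) * φ x) 0 := by
    refine (hasDerivAt_integral_of_dominated_loc_of_deriv_le
      (F := fun t x => primitive h (u x + t * φ x)) (F' := fun t x => h (u x + t * φ x) * φ x)
      (bound := fun x => B * |φ x|) univ_mem (Eventually.of_forall fun t => ?_) ?_ ?_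
      (ae_of_all _ fun x t _ => ?_) ?_ (ae_of_all _ fun x t _ => ?_)).2
    · exact (continuous_primitive hc).comp_aestronglyMeasurable (hpath t).memLp.1.restrict
    · exact integrableOn_primitive hΩf hc hB (hpath 0)
    · exact (hc.comp_aestronglyMeasurable (hpath 0).memLp.1.restrict).mul hφ.memLp.1.restrict
    · rw [norm_mul, Real.norm_eq_abs, Real.norm_eq_abs]
      exact mul_le_mul_of_nonneg_right (hB _) (abs_nonneg _)
    · exact (hφ.integrableOn hΩf).norm.const_mul B
    · have hline : HasDerivAt (fun t : ℝ => u x + t * φ x) (φ x) t := by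
        simpa using ((hasDerivAt_id t).mul_const (φ x)).const_add (u x)
      exact HasDerivAt.comp (h₂ := primitive h) t (hasDerivAt_primitive hc _) hline
  simp only [zero_mul, add_zero] at hI
  -- Along a line the quadratic part is a polynomial in `t`, whose linear coefficient is the wanted
  -- form.
  have hQ : HasDerivAt (fun t : ℝ => (gagliardoForm s u u + t * (2 * gagliardoForm s u φ) +
      t ^ 2 * gagliardoForm s φ φ) / 2) (gagliardoForm s u φ) 0 := by
    have h1 := (((hasDerivAt_id (0 : ℝ)).mul_const (2 * gagliardoForm s u φ)).const_add
      (gagliardoForm s u u)).add ((hasDerivAt_pow 2 (0 : ℝ)).mul_const (gagliardoForm s φ φ))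
    convert! h1.div_const 2 using 1
    simp
  have hE := hQ.sub hI
  have hloc : IsLocalMin (fun t : ℝ => energy s Ω h (fun x => u x + t * φ x)) 0 := by
    refine Eventually.of_forall fun t => ?_
    simpa using hmin _ (hpath t)
  have hE' : HasDerivAt (fun t : ℝ => energy s Ω h (fun x => u x + t * φ x))
      (gagliardoForm s u φ - ∫ x in Ω, h (u x) * φ x) 0 := by
    refine hE.congr_of_eventuallyEq (Eventually.of_forall fun t => ?_)
    simp only [energy, gagliardoForm_add_mul hu hφ, Pi.sub_apply]
  exact sub_eq_zero.mp (hloc.hasDerivAt_eq_zero hE')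

end Minimization

/-! ### The nonlocal strong maximum principle. -/

/-- The piecewise linear function decreasing from `1` at the origin to `0` at `1 / (n + 1)`. -/
noncomputable def hat (n : ℕ) (t : ℝ) : ℝ := max 0 (1 - ((n : ℝ) + 1) * t)

section Hat

theorem continuous_hat (n : ℕ) : Continuous (hat n) := by
  unfold hat
  fun_prop

theorem hat_nonneg (n : ℕ) (t : ℝ) : 0 ≤ hat n t := le_max_left _ _

theorem hat_le_one (n : ℕ) {t : ℝ} (ht : 0 ≤ t) : hat n t ≤ 1 := by
  refine max_le zero_le_one ?_
  have : 0 ≤ ((n : ℝ) + 1) * t := by positivity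
  linarith

theorem abs_hat_sub_le (n : ℕ) (a b : ℝ) : |hat n a - hat n b| ≤ ((n : ℝ) + 1) * |a - b| := by
  unfold hat
  refine (abs_max_sub_max_le_max _ _ _ _).trans (max_le (by simp; positivity) (le_of_eq ?_))
  have : 1 - ((n : ℝ) + 1) * a - (1 - ((n : ℝ) + 1) * b) = -(((n : ℝ) + 1) * (a - b)) := by ring
  rw [this, abs_neg, abs_mul, abs_of_nonneg (by positivity : (0 : ℝ) ≤ (n : ℝ) + 1)]

theorem hat_antitone (n : ℕ) : Antitone (hat n) := fun a b hab => by
  unfold hat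
  have : (0 : ℝ) ≤ (n : ℝ) + 1 := by positivity
  exact max_le_max le_rfl (by nlinarith)

theorem hat_zero (n : ℕ) : hat n 0 = 1 := by simp [hat]

theorem tendsto_hat_of_pos {t : ℝ} (ht : 0 < t) : Tendsto (fun n => hat n t) atTop (𝓝 0) := by
  refine tendsto_const_nhds.congr' ?_
  obtain ⟨n₀, hn₀⟩ := exists_nat_ge (1 / t)
  filter_upwards [eventually_ge_atTop n₀] with n hn
  have h1 : 1 / t ≤ (n : ℝ) := hn₀.trans (by exact_mod_cast hn)
  rw [div_le_iff₀ ht] at h1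
  rw [hat, max_eq_left]
  nlinarith

end Hat

section Positivity

variable {N : ℕ} {s : ℝ} {Ω : Set (Euc N)} {h : ℝ → ℝ} {B : ℝ} {u : Euc N → ℝ}

/-- Symmetrize: `g a * e - g b * e'` equals `(e - e') * (g a + g b) / 2 + (g a - g b) * (e + e') /
2`, and the second term has the sign opposite to `a - b`. The resulting bound does not involve the
Lipschitz constant of `g`. -/
theorem sub_mul_antitone_mul_sub_le {g : ℝ → ℝ} (hg : Antitone g) {a b e e' : ℝ}
    (ha0 : 0 ≤ g a) (ha1 : g a ≤ 1) (hb0 : 0 ≤ g b) (hb1 : g b ≤ 1) (he : 0 ≤ e) (he' : 0 ≤ e') :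
    (a - b) * (g a * e - g b * e') ≤ |a - b| * |e - e'| := by
  have h1 : (a - b) * (g a - g b) ≤ 0 := by
    rcases le_total a b with hab | hab
    · exact mul_nonpos_of_nonpos_of_nonneg (sub_nonpos.mpr hab) (sub_nonneg.mpr (hg hab))
    · exact mul_nonpos_of_nonneg_of_nonpos (sub_nonneg.mpr hab) (sub_nonpos.mpr (hg hab))
  have h2 : (a - b) * (e - e') * ((g a + g b) / 2) ≤ |a - b| * |e - e'| := by
    have h3 : (a - b) * (e - e') ≤ |a - b| * |e - e'| := by
      rw [← abs_mul]
      exact le_abs_self _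
    have h4 : 0 ≤ |a - b| * |e - e'| := by positivity
    calc (a - b) * (e - e') * ((g a + g b) / 2)
        ≤ |a - b| * |e - e'| * ((g a + g b) / 2) :=
          mul_le_mul_of_nonneg_right h3 (by linarith)
      _ ≤ |a - b| * |e - e'| := mul_le_of_le_one_right h4 (by linarith)
  have h5 : (a - b) * (g a - g b) * ((e + e') / 2) ≤ 0 :=
    mul_nonpos_of_nonpos_of_nonneg h1 (by linarith)
  linarith

theorem diffQuot_mul_diffQuot_zeroSet_nonpos {η : Euc N → ℝ} (hu0 : ∀ x, 0 ≤ u x)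
    (hη0 : ∀ x, 0 ≤ η x) (z : Euc N × Euc N) :
    diffQuot s u z * diffQuot s (fun x => if u x = 0 then η x else 0) z ≤ 0 := by
  rw [diffQuot_mul_diffQuot]
  refine div_nonpos_of_nonpos_of_nonneg ?_ (by positivity)
  have := mul_nonneg (hu0 z.1) (hη0 z.2)
  have := mul_nonneg (hu0 z.2) (hη0 z.1)
  split_ifs with h1 h2 h2 <;> simp_all

/-- The nonlocal strong maximum principle: a nonnegative weak solution vanishes either almost
everywhere, or almost nowhere in the set where a given cutoff function is positive. -/
theorem zeroSet_null_or_ae_eq_zero (hΩf : volume Ω ≠ ⊤) (hc : Continuous h) (h0 : h 0 = 0)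
    (hB : ∀ t, |h t| ≤ B) (hu : MemX0 s Ω u) (hu0 : ∀ x, 0 ≤ u x)
    (hweak : ∀ φ, MemX0 s Ω φ → gagliardoForm s u φ = ∫ x in Ω, h (u x) * φ x)
    {η : Euc N → ℝ} (hη : MemX0 s Ω η) (hη0 : ∀ x, 0 ≤ η x) (hη1 : ∀ x, η x ≤ 1) :
    volume {x | u x = 0 ∧ 0 < η x} = 0 ∨ volume {x | 0 < u x} = 0 := by
  have hηabs : ∀ x, |η x| ≤ 1 := fun x => by rw [abs_of_nonneg (hη0 x)]; exact hη1 x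
  -- Admissible test functions decreasing to `η` restricted to `{u = 0}`, which itself need not be
  -- admissible.
  set φ : ℕ → Euc N → ℝ := fun n x => hat n (u x) * η x with hφdef
  have hφ : ∀ n, MemX0 s Ω (φ n) := fun n =>
    hη.mul_bounded ((continuous_hat n).comp_aestronglyMeasurable hu.memLp.1)
      (memLp_diffQuot_comp (continuous_hat n) (abs_hat_sub_le n) hu.memLp.1 hu.diffQuot_memLp)
      hηabs fun x => by
        rw [abs_of_nonneg (hat_nonneg _ _)]
        exact hat_le_one n (hu0 x)
  set ψ : Euc N → ℝ := fun x => if u x = 0 then η x else 0 with hψdef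
  have hφψ : ∀ x, Tendsto (fun n => φ n x) atTop (𝓝 (ψ x)) := fun x => by
    by_cases hx : u x = 0
    · simp only [hφdef, hψdef, hx, hat_zero, one_mul, if_true]
      exact tendsto_const_nhds
    · simp only [hψdef, if_neg hx]
      simpa using (tendsto_hat_of_pos (lt_of_le_of_ne (hu0 x) (Ne.symm hx))).mul_const (η x)
  have hψm : AEStronglyMeasurable ψ volume :=
    aestronglyMeasurable_of_tendsto_ae atTop (fun n => (hφ n).memLp.1) (ae_of_all _ hφψ)
  -- Where `u = 0` the reaction vanishes by `h 0 = 0`; elsewhere the test functions tend to 0.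
  have hrhs : Tendsto (fun n => ∫ x in Ω, h (u x) * φ n x) atTop (𝓝 0) := by
    have := tendsto_integral_of_dominated_convergence (μ := volume.restrict Ω)
      (F := fun n x => h (u x) * φ n x) (f := fun _ => 0) (fun x => B * |η x|)
      (fun n => (hc.comp_aestronglyMeasurable hu.memLp.1.restrict).mul (hφ n).memLp.1.restrict)
      ((hη.integrableOn hΩf).norm.const_mul B)
      (fun n => ae_of_all _ fun x => by
        rw [norm_mul, Real.norm_eq_abs, Real.norm_eq_abs]
        refine mul_le_mul (hB _) ?_ (abs_nonneg _) ((abs_nonneg _).trans (hB 0))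
        rw [abs_mul, abs_of_nonneg (hat_nonneg _ _)]
        exact mul_le_of_le_one_left (abs_nonneg _) (hat_le_one n (hu0 x)))
      (ae_of_all _ fun x => by
        have h1 := (hφψ x).const_mul (h (u x))
        by_cases hx : u x = 0
        · simp [hx, h0]
        · simpa [hψdef, hx] using h1)
    simpa using this
  -- An integrable upper bound for the integrands, uniform in `n`. The Lipschitz constants of `hat
  -- n` blow up, so only this one-sided bound is available, and Fatou replaces dominated
  -- convergence.
  set c : Euc N × Euc N → ℝ := fun z => |diffQuot s u z| * |diffQuot s η z| with hcdef
  have hcint : Integrable c :=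
    (hu.diffQuot_memLp.norm.integrable_mul hη.diffQuot_memLp.norm)
  have hPint : ∀ n, Integrable (fun z => diffQuot s u z * diffQuot s (φ n) z) := fun n =>
    hu.diffQuot_memLp.integrable_mul (hφ n).diffQuot_memLp
  have hle : ∀ n z, diffQuot s u z * diffQuot s (φ n) z ≤ c z := fun n z => by
    simp only [hcdef]
    rw [diffQuot_mul_diffQuot, ← abs_mul, diffQuot_mul_diffQuot, abs_div,
      abs_of_nonneg (by positivity : 0 ≤ ‖z.1 - z.2‖ ^ ((N : ℝ) + 2 * s)), abs_mul]
    refine div_le_div_of_nonneg_right ?_ (by positivity)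
    exact sub_mul_antitone_mul_sub_le (hat_antitone n) (hat_nonneg _ _) (hat_le_one n (hu0 _))
      (hat_nonneg _ _) (hat_le_one n (hu0 _)) (hη0 _) (hη0 _)
  set P : Euc N × Euc N → ℝ := fun z => diffQuot s u z * diffQuot s ψ z with hPdef
  have hP0 : ∀ z, P z ≤ 0 := diffQuot_mul_diffQuot_zeroSet_nonpos hu0 hη0
  have hPm : AEStronglyMeasurable P volume :=
    (aestronglyMeasurable_diffQuot hu.memLp.1).mul (aestronglyMeasurable_diffQuot hψm)
  have hlim : ∀ z, Tendsto (fun n => ENNReal.ofReal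
      (c z - diffQuot s u z * diffQuot s (φ n) z)) atTop (𝓝 (ENNReal.ofReal (c z - P z))) :=
    fun z => ENNReal.tendsto_ofReal (tendsto_const_nhds.sub
      ((((hφψ z.1).sub (hφψ z.2)).div_const _).const_mul _))
  have hfatou : ∫⁻ z, ENNReal.ofReal (c z - P z) ≤ ENNReal.ofReal (∫ z, c z) := by
    have h1 : Tendsto (fun n => ∫⁻ z, ENNReal.ofReal
        (c z - diffQuot s u z * diffQuot s (φ n) z)) atTop (𝓝 (ENNReal.ofReal (∫ z, c z))) := by
      have h2 : ∀ n, ∫⁻ z, ENNReal.ofReal (c z - diffQuot s u z * diffQuot s (φ n) z) =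
          ENNReal.ofReal ((∫ z, c z) - ∫ x in Ω, h (u x) * φ n x) := fun n => by
        rw [← hweak _ (hφ n), gagliardoForm_eq, ← integral_sub hcint (hPint n)]
        exact (ofReal_integral_eq_lintegral_ofReal (hcint.sub (hPint n))
          (ae_of_all _ fun z => sub_nonneg.mpr (hle n z))).symm
      simp only [h2]
      have h3 := ENNReal.tendsto_ofReal ((tendsto_const_nhds (x := ∫ z, c z)).sub hrhs)
      rwa [sub_zero] at h3
    calc ∫⁻ z, ENNReal.ofReal (c z - P z)
        = ∫⁻ z, liminf (fun n => ENNReal.ofReal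
            (c z - diffQuot s u z * diffQuot s (φ n) z)) atTop :=
          lintegral_congr fun z => (hlim z).liminf_eq.symm
      _ ≤ liminf (fun n => ∫⁻ z, ENNReal.ofReal
            (c z - diffQuot s u z * diffQuot s (φ n) z)) atTop :=
          lintegral_liminf_le' fun n => (hcint.sub (hPint n)).1.aemeasurable.ennreal_ofReal
      _ = _ := h1.liminf_eq
  have hsplit : ∫⁻ z, ENNReal.ofReal (c z - P z) =
      ENNReal.ofReal (∫ z, c z) + ∫⁻ z, ENNReal.ofReal (-P z) := by
    rw [ofReal_integral_eq_lintegral_ofReal hcint (ae_of_all _ fun z => by positivity),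
      ← lintegral_add_left' hcint.1.aemeasurable.ennreal_ofReal]
    refine lintegral_congr fun z => ?_
    rw [sub_eq_add_neg, ENNReal.ofReal_add (by positivity) (neg_nonneg.mpr (hP0 z))]
  -- The finite term `∫ c` cancels, so the nonpositive limit integrand vanishes almost everywhere.
  have hzero : ∫⁻ z, ENNReal.ofReal (-P z) = 0 := by
    rw [hsplit] at hfatou
    by_contra hne
    exact absurd hfatou (not_le.mpr (ENNReal.lt_add_right ENNReal.ofReal_ne_top hne))
  have hPm' : AEMeasurable (fun z => ENNReal.ofReal (-P z)) volume :=
    hPm.neg.aemeasurable.ennreal_ofReal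
  rw [lintegral_eq_zero_iff' hPm'] at hzero
  -- On this product the limit integrand is strictly negative, so the product is null and one factor
  -- must be.
  have hnull : (volume : Measure (Euc N × Euc N))
      ({x | u x = 0 ∧ 0 < η x} ×ˢ {x | 0 < u x}) = 0 := by
    refine measure_mono_null ?_ hzero
    rintro ⟨x, y⟩ ⟨⟨hx, hηx⟩, hy⟩ hz
    have hy : 0 < u y := hy
    have hxy : x ≠ y := by
      rintro rfl
      exact hy.ne' hx
    have hK : 0 < ‖x - y‖ := norm_pos_iff.mpr (sub_ne_zero.mpr hxy)
    have hz' : ENNReal.ofReal (-P (x, y)) = 0 := hz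
    have hP : P (x, y) = -(u y * η x / ‖x - y‖ ^ ((N : ℝ) + 2 * s)) := by
      simp only [hPdef]
      rw [diffQuot_mul_diffQuot]
      simp only [hψdef, hx, hy.ne', if_true, if_false]
      ring
    rw [hP, neg_neg, ENNReal.ofReal_eq_zero] at hz'
    exact absurd hz' (not_le.mpr (by positivity))
  rw [Measure.volume_eq_prod, Measure.prod_prod, mul_eq_zero] at hnull
  exact hnull

theorem ae_pos_of_weak_eq (hN : N ≠ 0) (hs0 : 0 < s) (hs1 : s < 1) (hΩo : IsOpen Ω)
    (hΩf : volume Ω ≠ ⊤) (hc : Continuous h) (h0 : h 0 = 0) (hB : ∀ t, |h t| ≤ B)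
    (hu : MemX0 s Ω u) (hu0 : ∀ x, 0 ≤ u x)
    (hweak : ∀ φ, MemX0 s Ω φ → gagliardoForm s u φ = ∫ x in Ω, h (u x) * φ x)
    (hne : ¬ u =ᵐ[volume] 0) : ∀ᵐ x, x ∈ Ω → 0 < u x := by
  have hpos : volume {x | 0 < u x} ≠ 0 := fun hz => hne <| by
    have : ∀ᵐ x, ¬ 0 < u x := by simpa [ae_iff] using hz
    filter_upwards [this] with x hx
    exact le_antisymm (not_lt.mp hx) (hu0 x)
  have hnull : volume {x | ¬ (x ∈ Ω → 0 < u x)} = 0 := by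
    refine measure_null_of_locally_null _ fun a ha => ?_
    obtain ⟨haΩ, -⟩ := Classical.not_imp.mp ha
    obtain ⟨r, hr, hrΩ⟩ := Metric.isOpen_iff.mp hΩo a haΩ
    have hr2 : 0 < r / 2 := half_pos hr
    have hη : MemX0 s Ω (cutoff a (r / 2)) :=
      memX0_cutoff hN hs0 hs1 hr2 (by rwa [mul_div_cancel₀ r two_ne_zero])
    have hZ := (zeroSet_null_or_ae_eq_zero hΩf hc h0 hB hu hu0 hweak hη (cutoff_nonneg a _)
      (cutoff_le_one a _)).resolve_right hpos
    refine ⟨_, inter_mem_nhdsWithin _ (Metric.ball_mem_nhds a hr2), measure_mono_null ?_ hZ⟩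
    rintro x ⟨hx, hxb⟩
    refine ⟨le_antisymm (not_lt.mp (Classical.not_imp.mp hx).2) (hu0 x), ?_⟩
    rw [cutoff_eq_one hr2 hxb]
    exact one_pos
  exact hnull

end Positivity

/-! ### Consequences of the oscillation condition. -/

section Oscillation

variable {f : ℝ → ℝ}

theorem OscillatesAtZero.exists_neg_sq_le (hosc : OscillatesAtZero f) :
    ∃ C, 0 ≤ C ∧ ∃ τ, 0 < τ ∧ ∀ t, 0 < t → t < τ → -(C * t ^ 2) ≤ primitive f t := by
  obtain ⟨c, -, hc⟩ := EReal.lt_iff_exists_real_btwn.mp hosc.liminf_primitive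
  have h := eventually_lt_of_lt_liminf hc
  rw [eventually_nhdsWithin_iff, Metric.eventually_nhds_iff] at h
  obtain ⟨τ, hτ, hball⟩ := h
  refine ⟨|c|, abs_nonneg c, τ, hτ, fun t ht0 ht => ?_⟩
  have h1 := hball (y := t) (by rwa [Real.dist_eq, sub_zero, abs_of_pos ht0]) ht0
  rw [EReal.coe_lt_coe_iff, lt_div_iff₀ (by positivity)] at h1
  have h2 : -(|c| * t ^ 2) ≤ c * t ^ 2 := by
    rw [← neg_mul]
    exact mul_le_mul_of_nonneg_right (neg_abs_le c) (sq_nonneg t)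
  exact h2.trans h1.le

theorem exists_mem_Ioo_of_frequently {P : ℝ → Prop} (h : ∃ᶠ t in 𝓝[>] (0 : ℝ), P t) {ε : ℝ}
    (hε : 0 < ε) : ∃ t, 0 < t ∧ t < ε ∧ P t := by
  obtain ⟨t, hP, ht⟩ := (h.and_eventually (Ioo_mem_nhdsGT hε)).exists
  exact ⟨t, ht.1, ht.2, hP⟩

theorem OscillatesAtZero.exists_sq_lt_primitive (hosc : OscillatesAtZero f) (M : ℝ) {ε : ℝ}
    (hε : 0 < ε) : ∃ t, 0 < t ∧ t < ε ∧ M * t ^ 2 < primitive f t := by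
  have h1 : (M : EReal) < limsup (fun t : ℝ => (((∫ τ in (0 : ℝ)..t, f τ) / t ^ 2 : ℝ) : EReal))
      (𝓝[>] 0) := by
    rw [hosc.limsup_primitive]
    exact EReal.coe_lt_top M
  obtain ⟨t, ht0, ht, hM⟩ := exists_mem_Ioo_of_frequently (frequently_lt_of_lt_limsup (h := h1)) hε
  rw [EReal.coe_lt_coe_iff, lt_div_iff₀ (by positivity)] at hM
  exact ⟨t, ht0, ht, hM⟩

theorem OscillatesAtZero.exists_neg (hosc : OscillatesAtZero f) {ε : ℝ} (hε : 0 < ε) :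
    ∃ t, 0 < t ∧ t < ε ∧ f t < 0 := by
  obtain ⟨t, ht0, ht, hf⟩ :=
    exists_mem_Ioo_of_frequently (frequently_lt_of_liminf_lt (h := hosc.liminf_neg)) hε
  refine ⟨t, ht0, ht, ?_⟩
  have h : f t / t < 0 := by exact_mod_cast hf
  rwa [div_lt_iff₀ ht0, zero_mul] at h

end Oscillation

/-! ### The truncated reaction. -/

/-- The nonlinearity `lam * t^p + f(t)`, extended by constants outside `[0, d]`. -/
noncomputable def reaction (f : ℝ → ℝ) (p lam d t : ℝ) : ℝ := lam * clamp d t ^ p + f (clamp d t)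

section Reaction

variable {f : ℝ → ℝ} {p lam d B : ℝ}

theorem continuous_reaction (hf : ContinuousOn f (Set.Ici 0)) (hp : 0 < p) (lam d : ℝ) :
    Continuous (reaction f p lam d) :=
  (continuous_const.mul ((continuous_clamp d).rpow_const fun _ => Or.inr hp.le)).add
    (hf.comp_continuous (continuous_clamp d) fun t => clamp_nonneg d t)

theorem reaction_of_mem {t : ℝ} (h0 : 0 ≤ t) (hd : t ≤ d) :
    reaction f p lam d t = lam * t ^ p + f t := by
  rw [reaction, clamp_of_mem h0 hd]

theorem reaction_of_nonpos (hf0 : f 0 = 0) (hp : 0 < p) (hd : 0 ≤ d) {t : ℝ} (ht : t ≤ 0) :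
    reaction f p lam d t = 0 := by
  rw [reaction, clamp_of_nonpos hd ht, Real.zero_rpow hp.ne', hf0, mul_zero, add_zero]

theorem abs_mul_rpow_le (hp : 0 < p) {t : ℝ} (h0 : 0 ≤ t) (h1 : t ≤ 1) :
    |lam * t ^ p| ≤ |lam| := by
  rw [abs_mul, abs_of_nonneg (Real.rpow_nonneg h0 p)]
  exact mul_le_of_le_one_right (abs_nonneg _) (Real.rpow_le_one h0 h1 hp.le)

theorem reaction_nonpos (hp : 0 < p) (hd : 0 ≤ d) (hd1 : d ≤ 1) (hlam : |lam| ≤ -f d) {t : ℝ}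
    (ht : d ≤ t) : reaction f p lam d t ≤ 0 := by
  rw [reaction, clamp_of_ge hd ht]
  have := (le_abs_self _).trans (abs_mul_rpow_le (lam := lam) hp hd hd1)
  linarith

theorem abs_reaction_le (hp : 0 < p) (hd : 0 ≤ d) (hd1 : d ≤ 1) (hlam : |lam| ≤ 1)
    (hB : ∀ t, 0 ≤ t → t ≤ 1 → |f t| ≤ B) (t : ℝ) : |reaction f p lam d t| ≤ 1 + B := by
  have h0 := clamp_nonneg d t
  have h1 := (clamp_le hd t).trans hd1
  exact (abs_add_le _ _).trans (add_le_add ((abs_mul_rpow_le hp h0 h1).trans hlam) (hB _ h0 h1))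

/-- For heights at most 1 the power term costs the primitive at most `|lam|`, whatever the sign of
`lam`. -/
theorem primitive_sub_le_primitive_reaction (hf : ContinuousOn f (Set.Ici 0)) (hp : 0 < p)
    (hd1 : d ≤ 1) {t : ℝ} (h0 : 0 ≤ t) (ht : t ≤ d) :
    primitive f t - |lam| ≤ primitive (reaction f p lam d) t := by
  have hfi : IntervalIntegrable f volume 0 t :=
    (hf.mono (by rw [Set.uIcc_of_le h0]; exact fun x hx => hx.1)).intervalIntegrable
  have h1 : primitive f t - |lam| * t = ∫ τ in (0 : ℝ)..t, (f τ - |lam|) := by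
    rw [intervalIntegral.integral_sub hfi intervalIntegrable_const]
    simp [primitive, mul_comm]
  have h2 : ∫ τ in (0 : ℝ)..t, (f τ - |lam|) ≤ primitive (reaction f p lam d) t := by
    refine intervalIntegral.integral_mono_on h0 (hfi.sub intervalIntegrable_const)
      ((continuous_reaction hf hp lam d).intervalIntegrable _ _) fun x hx => ?_
    rw [reaction_of_mem hx.1 (hx.2.trans ht)]
    have := (abs_le.mp (abs_mul_rpow_le (lam := lam) hp hx.1 (hx.2.trans (ht.trans hd1)))).1
    linarith
  have h3 : |lam| * t ≤ |lam| := mul_le_of_le_one_right (abs_nonneg _) (ht.trans hd1)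
  linarith

end Reaction

/-! ### Small solutions with a uniform lower bound. -/

section Solutions

variable {N : ℕ} {s : ℝ} {Ω : Set (Euc N)} {f : ℝ → ℝ} {p lam d : ℝ} {u : Euc N → ℝ}

theorem isWeakSolution_of_reaction (hΩf : volume Ω ≠ ⊤) (hf : ContinuousOn f (Set.Ici 0))
    (hp : 0 < p) (hu : MemX0 s Ω u) (hu0 : ∀ x, 0 ≤ u x) (hud : ∀ x, u x ≤ d)
    (hpos : ∀ᵐ x, x ∈ Ω → 0 < u x)
    (hweak : ∀ φ, MemX0 s Ω φ →
      gagliardoForm s u φ = ∫ x in Ω, reaction f p lam d (u x) * φ x) :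
    IsWeakSolution s Ω p lam f u := by
  have hint : ∀ g : ℝ → ℝ, ContinuousOn g (Set.Ici 0) → ∀ φ, MemX0 s Ω φ →
      IntegrableOn (fun x => g (u x) * φ x) Ω := by
    intro g hg φ hφ
    have hgc : Continuous fun t => g (clamp d t) :=
      hg.comp_continuous (continuous_clamp d) fun t => clamp_nonneg d t
    obtain ⟨C, hC⟩ := (isCompact_Icc (a := 0) (b := d)).exists_bound_of_continuousOn
      (hg.mono fun x hx => hx.1)
    refine (hφ.integrableOn hΩf).bdd_mul (c := C) ?_ (ae_of_all _ fun x => hC _ ⟨hu0 x, hud x⟩)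
    refine (hgc.comp_aestronglyMeasurable hu.memLp.1.restrict).congr (ae_of_all _ fun x => ?_)
    simp only [clamp_of_mem (hu0 x) (hud x)]
  have hpow := hint (fun t => t ^ p) (continuousOn_id.rpow_const fun _ _ => Or.inr hp.le)
  refine ⟨hu, hpos, hpow, hint f hf, fun φ hφ => ?_⟩
  rw [hweak φ hφ, ← integral_const_mul, ← integral_add ((hpow φ hφ).const_mul lam) (hint f hf φ hφ)]
  refine integral_congr_ae (ae_of_all _ fun x => ?_)
  simp only [reaction_of_mem (hu0 x) (hud x)]
  ring

/-- The energy is negative at a small multiple of a cutoff function whose height makes the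
primitive of the nonlinearity large. -/
theorem energy_cutoff_le (hN : N ≠ 0) (hs0 : 0 < s) (hs1 : s < 1)
    (hΩf : volume Ω ≠ ⊤) {a : Euc N} {r : ℝ} (hr : 0 < r) (hrΩ : Metric.ball a (2 * r) ⊆ Ω)
    {h : ℝ → ℝ} {B C M t l : ℝ} (hc : Continuous h) (hB : ∀ t, |h t| ≤ B) (ht : 0 < t)
    (hC : ∀ τ, 0 ≤ τ → τ ≤ t → -(C * t ^ 2) - l ≤ primitive h τ)
    (htM : (M - C) * t ^ 2 - l ≤ primitive h t) :
    energy s Ω h (fun x => t * cutoff a r x) ≤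
      t ^ 2 * gagliardoForm s (cutoff a r) (cutoff a r) / 2 -
        (M * t ^ 2 * volume.real (Metric.ball a r) - (C * t ^ 2 + l) * volume.real Ω) := by
  have hη := (memX0_cutoff hN hs0 hs1 hr hrΩ).const_mul t
  have hball : MeasurableSet (Metric.ball a r) := Metric.isOpen_ball.measurableSet
  have hsub : Metric.ball a r ⊆ Ω := (Metric.ball_subset_ball (by linarith)).trans hrΩ
  have hi1 : IntegrableOn ((Metric.ball a r).indicator fun _ => M * t ^ 2) Ω :=
    (integrableOn_const hΩf).indicator hball
  have hi2 : IntegrableOn (fun _ : Euc N => C * t ^ 2 + l) Ω := integrableOn_const hΩf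
  have hle : ∫ x in Ω, ((Metric.ball a r).indicator (fun _ => M * t ^ 2) x - (C * t ^ 2 + l)) ≤
      ∫ x in Ω, primitive h (t * cutoff a r x) := by
    refine setIntegral_mono (hi1.sub hi2) (integrableOn_primitive hΩf hc hB hη) fun x => ?_
    by_cases hx : x ∈ Metric.ball a r
    · simp only [Set.indicator_of_mem hx, cutoff_eq_one hr hx, mul_one]
      linarith
    · simp only [Set.indicator_of_notMem hx]
      have := hC (t * cutoff a r x) (mul_nonneg ht.le (cutoff_nonneg a r x))
        (mul_le_of_le_one_right ht.le (cutoff_le_one a r x))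
      linarith
  rw [integral_sub hi1 hi2, setIntegral_indicator hball, Set.inter_eq_self_of_subset_right hsub,
    setIntegral_const, setIntegral_const, smul_eq_mul, smul_eq_mul] at hle
  rw [energy, gagliardoForm_const_mul_self]
  linarith

/-- For small `|lam|` there is a weak solution of arbitrarily small norm whose supremum is bounded
below uniformly in `lam`. -/
theorem exists_small_weakSolution (hN : N ≠ 0) (hs0 : 0 < s) (hs1 : s < 1) (hΩo : IsOpen Ω)
    (hΩne : Ω.Nonempty) (hΩf : volume Ω ≠ ⊤) (hf : ContinuousOn f (Set.Ici 0)) (hf0 : f 0 = 0)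
    (hosc : OscillatesAtZero f) (hp : 0 < p) {ε : ℝ} (hε : 0 < ε) :
    ∃ c, 0 < c ∧ ∃ L, 0 < L ∧ ∀ lam, |lam| ≤ L → ∃ u : Euc N → ℝ,
      IsWeakSolution s Ω p lam f u ∧ gagliardoNorm s u < ENNReal.ofReal ε ∧
      eLpNorm u ⊤ (volume.restrict Ω) < ENNReal.ofReal ε ∧
      ENNReal.ofReal c ≤ eLpNorm u ⊤ (volume.restrict Ω) := by
  have hΩm := hΩo.measurableSet
  obtain ⟨B₀, hB₀⟩ := (isCompact_Icc (a := (0 : ℝ)) (b := 1)).exists_bound_of_continuousOn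
    (hf.mono fun x hx => hx.1)
  have hB₀' : ∀ t, 0 ≤ t → t ≤ 1 → |f t| ≤ B₀ := fun t h0 h1 => hB₀ t ⟨h0, h1⟩
  have hB₀0 : 0 ≤ B₀ := (abs_nonneg _).trans (hB₀' 0 le_rfl zero_le_one)
  set V := volume.real Ω with hV
  have hV0 : 0 ≤ V := measureReal_nonneg
  obtain ⟨a, ha⟩ := hΩne
  obtain ⟨R, hR, hRΩ⟩ := Metric.isOpen_iff.mp hΩo a ha
  set r := R / 2 with hrdef
  have hr : 0 < r := half_pos hR
  have hrΩ : Metric.ball a (2 * r) ⊆ Ω := by rwa [hrdef, mul_div_cancel₀ R two_ne_zero]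
  set Q := gagliardoForm s (cutoff a r) (cutoff a r) with hQ
  have hQ0 : 0 ≤ Q := gagliardoForm_self_nonneg _
  set b := volume.real (Metric.ball a r) with hb
  have hb0 : 0 < b :=
    ENNReal.toReal_pos (Metric.measure_ball_pos volume a hr).ne' measure_ball_lt_top.ne
  obtain ⟨C, hC0, τ, hτ, hC⟩ := hosc.exists_neg_sq_le
  -- The bounds on `d` serve in turn: the supremum estimate, `t ^ p ≤ 1`, the quadratic lower bound
  -- for `F` on `(0, d)`, and the seminorm estimate. The final `+ 1` keeps the denominator positive.
  obtain ⟨d, hd0, hd, hfd⟩ := hosc.exists_neg (ε := min (min ε 1) (min τ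
    (ε ^ 2 / (2 * (1 + B₀) * V + 1)))) (by positivity)
  obtain ⟨⟨hdε, hd1⟩, hdτ, hdV⟩ : (d < ε ∧ d < 1) ∧ d < τ ∧
      d < ε ^ 2 / (2 * (1 + B₀) * V + 1) := by simpa only [lt_min_iff] using hd
  rw [lt_div_iff₀ (by positivity)] at hdV
  -- This factor makes the plateau gain equal `(Q / 2 + C * V + 1) * t ^ 2`, covering seminorm and
  -- transition losses with `t ^ 2` to spare; half of that absorbs `|lam| * V`.
  obtain ⟨t, ht0, htd, htM⟩ :=
    hosc.exists_sq_lt_primitive ((Q / 2 + C * V + 1) / b) hd0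
  set M := (Q / 2 + C * V + 1) / b with hM
  refine ⟨t ^ 2 / (2 * ((1 + B₀) * V + 1)), by positivity,
    min (min 1 (-f d)) (t ^ 2 / (2 * (V + 1))), lt_min (lt_min one_pos (neg_pos.mpr hfd))
      (by positivity), fun lam hlam => ?_⟩
  obtain ⟨⟨hlam1, hlamd⟩, hlamt⟩ : (|lam| ≤ 1 ∧ |lam| ≤ -f d) ∧ |lam| ≤ t ^ 2 / (2 * (V + 1)) := by
    simpa only [le_min_iff] using hlam
  rw [le_div_iff₀ (by positivity)] at hlamt
  set h := reaction f p lam d with hh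
  have hhc : Continuous h := continuous_reaction hf hp lam d
  have hhB : ∀ t, |h t| ≤ 1 + B₀ := abs_reaction_le hp hd0.le hd1.le hlam1 hB₀'
  obtain ⟨u, huX, hu0, hud, hmin⟩ := exists_minimizer hN hs0 hΩm hΩf hd0.le hhc hhB
    (fun t ht => reaction_of_nonpos hf0 hp hd0.le ht)
    (fun t ht => reaction_nonpos hp hd0.le hd1.le hlamd ht)
  have hweak : ∀ φ, MemX0 s Ω φ → gagliardoForm s u φ = ∫ x in Ω, h (u x) * φ x :=
    fun φ hφ => gagliardoForm_eq_of_minimizer hΩf hhc hhB huX hmin hφ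
  have hEu : energy s Ω h u ≤ -(t ^ 2 / 2) := by
    refine (hmin _ ((memX0_cutoff hN hs0 hs1 hr hrΩ).const_mul t)).trans ?_
    refine (energy_cutoff_le (C := C) (M := M) (l := |lam|) hN hs0 hs1 hΩf hr hrΩ hhc hhB ht0
      (fun σ hσ0 hσ => ?_) ?_).trans ?_
    · refine le_trans ?_ (primitive_sub_le_primitive_reaction hf hp hd1.le hσ0 (hσ.trans htd.le))
      rcases hσ0.eq_or_lt with rfl | hσ0
      · rw [primitive_zero]
        have : 0 ≤ C * t ^ 2 := by positivity
        linarith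
      · have h1 := hC σ hσ0 (hσ.trans_lt (htd.trans hdτ))
        have h2 : C * σ ^ 2 ≤ C * t ^ 2 :=
          mul_le_mul_of_nonneg_left (pow_le_pow_left₀ hσ0.le hσ 2) hC0
        linarith
    · refine le_trans ?_ (primitive_sub_le_primitive_reaction hf hp hd1.le ht0.le htd.le)
      have : 0 ≤ C * t ^ 2 := by positivity
      linarith
    · have h1 : M * t ^ 2 * b = (Q / 2 + C * V + 1) * t ^ 2 := by
        rw [hM]
        field_simp
      rw [← hQ, ← hb, h1]
      nlinarith [abs_nonneg lam]
  -- Negative energy bounds the form by twice the potential, which is at most `(1 + B₀) * d * V`.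
  have hform : gagliardoForm s u u < ε ^ 2 := by
    have h1 : ∫ x in Ω, primitive h (u x) ≤ (1 + B₀) * d * V :=
      setIntegral_primitive_le hΩf hhB fun x => by rw [abs_of_nonneg (hu0 x)]; exact hud x
    have h2 : 0 < t ^ 2 := by positivity
    unfold energy at hEu
    linarith
  -- Energy at most `-t ^ 2 / 2` needs a potential of at least `t ^ 2 / 2`, but the potential is at
  -- most `(1 + B₀) * V` times the supremum.
  have hsup : ENNReal.ofReal (t ^ 2 / (2 * ((1 + B₀) * V + 1))) ≤
      eLpNorm u ⊤ (volume.restrict Ω) := by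
    by_contra hlt
    rw [not_le] at hlt
    set c := t ^ 2 / (2 * ((1 + B₀) * V + 1)) with hc
    have hc' : c * (2 * ((1 + B₀) * V + 1)) = t ^ 2 := div_mul_cancel₀ _ (by positivity)
    have hc0 : 0 < c := by positivity
    have huc : ∀ᵐ x ∂volume.restrict Ω, |u x| ≤ c := by
      rw [eLpNorm_exponent_top] at hlt
      filter_upwards [ae_lt_of_essSup_lt hlt] with x hx
      rw [Real.enorm_eq_ofReal_abs] at hx
      exact ((ENNReal.ofReal_lt_ofReal_iff hc0).mp hx).le
    have h1 : ∫ x in Ω, primitive h (u x) ≤ (1 + B₀) * c * V := by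
      refine (Real.le_norm_self _).trans
        (norm_setIntegral_le_of_norm_le_const_ae hΩf.lt_top ?_)
      filter_upwards [huc] with x hx
      exact (abs_primitive_le hhB (u x)).trans (mul_le_mul_of_nonneg_left hx (by positivity))
    have h2 := gagliardoForm_self_nonneg (s := s) u
    unfold energy at hEu
    linarith
  have hne : ¬ u =ᵐ[volume] 0 := fun hu => by
    rw [eLpNorm_congr_ae (ae_restrict_of_ae hu), eLpNorm_zero, nonpos_iff_eq_zero,
      ENNReal.ofReal_eq_zero] at hsup
    exact absurd hsup (not_le.mpr (by positivity))
  have hpos := ae_pos_of_weak_eq hN hs0 hs1 hΩo hΩf hhc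
    (reaction_of_nonpos hf0 hp hd0.le le_rfl) hhB huX hu0 hweak hne
  refine ⟨u, isWeakSolution_of_reaction hΩf hf hp huX hu0 hud hpos hweak, ?_, ?_, hsup⟩
  · rw [gagliardoNorm_eq_ofReal_sqrt huX, ENNReal.ofReal_lt_ofReal_iff hε]
    rwa [Real.sqrt_lt' hε]
  · refine lt_of_le_of_lt ?_ ((ENNReal.ofReal_lt_ofReal_iff hε).mpr hdε)
    rw [eLpNorm_exponent_top]
    refine eLpNormEssSup_le_of_ae_bound (ae_of_all _ fun x => ?_)
    rw [Real.norm_eq_abs, abs_of_nonneg (hu0 x)]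
    exact hud x

end Solutions

end FracLap

/-! ### Induction on the number of solutions. -/

theorem theorem1p2 (N : ℕ) (s : ℝ) (hs0 : 0 < s) (hs1 : s < 1) (hN : 2 * s < (N : ℝ))
    (Ω : Set (EuclideanSpace ℝ (Fin N))) (hΩ : FracLap.IsBoundedSmoothDomain Ω)
    (f : ℝ → ℝ) (hf : ContinuousOn f (Set.Ici 0)) (hf0 : f 0 = 0)
    (hosc : FracLap.OscillatesAtZero f) (p : ℝ) (hp0 : 0 < p) (hp1 : p < 1) :
    ∀ k : ℕ, ∃ lamk : ℝ, 0 < lamk ∧ ∀ lam ∈ Set.Icc (-lamk) lamk,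
      ∃ u : ℕ → EuclideanSpace ℝ (Fin N) → ℝ,
        (∀ i ∈ Set.Icc 1 k,
          FracLap.IsWeakSolution s Ω p lam f (u i) ∧
          FracLap.gagliardoNorm s (u i) < ENNReal.ofReal (1 / (i : ℝ)) ∧
          eLpNorm (u i) ⊤ (volume.restrict Ω) < ENNReal.ofReal (1 / (i : ℝ))) ∧
        (∀ i ∈ Set.Icc 1 k, ∀ j ∈ Set.Icc 1 k, i ≠ j → ¬ (u i =ᵐ[volume] u j)) := by
  have hN0 : N ≠ 0 := by
    rintro rfl
    rw [Nat.cast_zero] at hN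
    linarith
  have hΩf : volume Ω ≠ ⊤ := hΩ.isBounded.measure_lt_top.ne
  -- The induction carries a lower bound `c` for all suprema, quantified before `lam`: the next
  -- solution must be chosen below it uniformly in `lam`.
  suffices H : ∀ k : ℕ, ∃ c, 0 < c ∧ ∃ lamk : ℝ, 0 < lamk ∧ ∀ lam ∈ Set.Icc (-lamk) lamk,
      ∃ u : ℕ → EuclideanSpace ℝ (Fin N) → ℝ,
        (∀ i ∈ Set.Icc 1 k,
          FracLap.IsWeakSolution s Ω p lam f (u i) ∧
          FracLap.gagliardoNorm s (u i) < ENNReal.ofReal (1 / (i : ℝ)) ∧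
          eLpNorm (u i) ⊤ (volume.restrict Ω) < ENNReal.ofReal (1 / (i : ℝ))) ∧
        (∀ i ∈ Set.Icc 1 k, ENNReal.ofReal c ≤ eLpNorm (u i) ⊤ (volume.restrict Ω)) ∧
        (∀ i ∈ Set.Icc 1 k, ∀ j ∈ Set.Icc 1 k, i < j → ¬ (u i =ᵐ[volume] u j)) by
    intro k
    obtain ⟨_, _, lamk, hlamk, h⟩ := H k
    refine ⟨lamk, hlamk, fun lam hlam => ?_⟩
    obtain ⟨u, hu, -, hne⟩ := h lam hlam
    refine ⟨u, hu, fun i hi j hj hij => ?_⟩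
    rcases lt_or_gt_of_ne hij with hlt | hlt
    · exact hne i hi j hj hlt
    · exact fun he => hne j hj i hi hlt he.symm
  intro k
  induction k with
  | zero =>
    have hempty : ∀ i ∈ Set.Icc 1 0, False := fun i hi => by
      have := hi.1.trans hi.2
      omega
    exact ⟨1, one_pos, 1, one_pos, fun lam _ => ⟨fun _ _ => 0, fun i hi => (hempty i hi).elim,
      fun i hi => (hempty i hi).elim, fun i hi => (hempty i hi).elim⟩⟩
  | succ k ih =>
    obtain ⟨c, hc, lamk, hlamk, hk⟩ := ih
    -- The bound `c` separates the new solution from all earlier ones; the other gives the required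
    -- size.
    have hε : 0 < min c (1 / ((k + 1 : ℕ) : ℝ)) := by positivity
    obtain ⟨c', hc', L, hL, hsol⟩ := FracLap.exists_small_weakSolution (p := p) hN0 hs0 hs1
      hΩ.isOpen hΩ.isConnected.nonempty hΩf hf hf0 hosc hp0 hε
    refine ⟨min c c', lt_min hc hc', min lamk L, lt_min hlamk hL, fun lam hlam => ?_⟩
    have habs : |lam| ≤ min lamk L := abs_le.mpr hlam
    obtain ⟨u, hu, huc, hne⟩ := hk lam (abs_le.mp (habs.trans (min_le_left _ _)))
    obtain ⟨v, hv, hvn, hvs, hvc⟩ := hsol lam (habs.trans (min_le_right _ _))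
    have hold : ∀ i, i ≤ k → Function.update u (k + 1) v i = u i := fun i hi =>
      Function.update_of_ne (by omega) _ _
    have hnew : Function.update u (k + 1) v (k + 1) = v := Function.update_self _ _ _
    refine ⟨Function.update u (k + 1) v, fun i hi => ?_, fun i hi => ?_, fun i hi j hj hij => ?_⟩
    · rcases Nat.le_succ_iff.mp hi.2 with h | rfl
      · rw [hold i h]
        exact hu i ⟨hi.1, h⟩
      · rw [hnew]
        have hle := ENNReal.ofReal_le_ofReal (min_le_right c (1 / ((k + 1 : ℕ) : ℝ)))
        exact ⟨hv, hvn.trans_le hle, hvs.trans_le hle⟩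
    · rcases Nat.le_succ_iff.mp hi.2 with h | rfl
      · rw [hold i h]
        exact (ENNReal.ofReal_le_ofReal (min_le_left _ _)).trans (huc i ⟨hi.1, h⟩)
      · rw [hnew]
        exact (ENNReal.ofReal_le_ofReal (min_le_right _ _)).trans hvc
    · have hik : i ≤ k := by
        have := hj.2
        omega
      rw [hold i hik]
      rcases Nat.le_succ_iff.mp hj.2 with h | rfl
      · rw [hold j h]
        exact hne i ⟨hi.1, hik⟩ j ⟨hj.1, h⟩ hij
      · rw [hnew]
        intro he
        have h1 := huc i ⟨hi.1, hik⟩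
        rw [eLpNorm_congr_ae (ae_restrict_of_ae he)] at h1
        exact absurd (hvs.trans_le (ENNReal.ofReal_le_ofReal (min_le_left _ _))) (not_lt.mpr h1)
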